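/- We work in the real projective plane. Let $\Gamma$ be (the set of real points of) a non-singular real cubic curve $G=0$, i.e. $G\in\mathbb R[X,Y,Z]$ is homogeneous of degree $3$ and the curve $G=0$ has no singular point in the complex projective plane. For points $P,Q$ on $\Gamma$ let $P\#Q$ be the third intersection point, counted with multiplicity, of $\Gamma$ with the line $PQ$ (with the tangent at $P$ if $P=Q$). For distinct lines $l,m$ let $l\wedge m$ be their intersection point. A step of Schroeter's construction produces from two pairs $P,\bar P$ and $Q,\bar Q$ the new pair $S:=PQ\wedge\bar P\bar Q$, $\bar S:=P\bar Q\wedge\bar PQ$, whenever $P,\bar P\notin\{Q,\bar Q\}$, $PQ\ne\bar P\bar Q$ and $P\bar Q\neq\bar PQ$. The Schroeter points generated by three pairs are the members of these three pairs and of all pairs obtained from them by finitely many steps. Theorem. Let $A,B,C$ be three distinct points on $\Gamma$. Then there are points $\bar A\ne A$, $\bar B\neq B$, $\bar C\neq C$ on $\Gamma$ and points $D,E,F$ on $\Gamma$ with $$D=A\#B=\bar A\#\bar B,\qquad E=B\#C=\bar B\#\bar C,\qquad F=C\#A=\bar C\#\bar A,$$ such that all Schroeter points generated by the pairs $A,\bar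 A$; $B,\bar B$; $C,\bar C$ lie on $\Gamma$. Moreover, these points can be chosen such that in addition the following holds, unless $(A,B,C)$ is exceptional: the six points $A,\bar A,B,\bar B,C,\bar C$ are pairwise distinct, no four of them are collinear, and Schroeter's construction can be applied to any two of the three pairs; in particular $$D=AB\wedge\bar A\bar B,\qquad E=BC\wedge\bar B\bar C,\qquad F=CA\wedge\bar C\bar A$$ are intersections of distinct lines. Here $(A,B,C)$ is called exceptional if two distinct points $P,Q$ among $A,B,C$ satisfy $P\#P=Q\#Q=R$ for some $R$ and there are no two distinct points $X,Y\in\Gamma\setminus\{A,B,C\}$ with $X\#X=Y\#Y=R$. -/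

import Mathlib

open scoped LinearAlgebra.Projectivization

noncomputable section

/-- Points of the real projective plane. -/
abbrev RPoint : Type := ℙ ℝ (Fin 3 → ℝ)

/-- Lines of the real projective plane, given by their homogeneous line coordinates. The point `P`
lies on the line `l` iff `P.orthogonal l`. -/
abbrev RLine : Type := ℙ ℝ (Fin 3 → ℝ)

/-- The line `PQ` through two distinct points (only meaningful for `P ≠ Q`). -/
def lineThrough (P Q : RPoint) : RLine := Projectivization.cross P Q

/-- The intersection point of two distinct lines (only meaningful for `l ≠ m`). -/
def wedge (l m : RLine) : RPoint := Projectivization.cross l m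

/-- `G` is the equation of a non-singular real cubic: a ternary cubic form over `ℝ` which has no
singular point in the complex projective plane. -/
def IsNonsingularCubic (G : MvPolynomial (Fin 3) ℝ) : Prop :=
  G.IsHomogeneous 3 ∧
    ∀ v : Fin 3 → ℂ, v ≠ 0 → MvPolynomial.aeval v G = 0 →
      ∃ i, MvPolynomial.aeval v (MvPolynomial.pderiv i G) ≠ 0

/-- The set of real points of the cubic `G = 0`. For homogeneous `G` the choice of the
representative does not matter. -/
def cubicCurve (G : MvPolynomial (Fin 3) ℝ) : Set RPoint :=
  {P | MvPolynomial.eval P.rep G = 0}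

/-- `R = P # Q`: there is a line (the two-dimensional subspace `W`) whose intersection with the
cubic `G = 0`, counted with multiplicity, consists of the three points `P`, `Q`, `R`; that is, the
restriction of `G` to `W` is a product of three linear forms whose zeros on the line are `P`, `Q`
and `R`. For `P = Q` the line is the tangent at `P`. -/
def IsThirdPoint (G : MvPolynomial (Fin 3) ℝ) (P Q R : RPoint) : Prop :=
  ∃ W : Submodule ℝ (Fin 3 → ℝ), Module.finrank ℝ W = 2 ∧
    ∃ a b c : Module.Dual ℝ (Fin 3 → ℝ),
      LinearMap.ker a ⊓ W = P.submodule ∧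
      LinearMap.ker b ⊓ W = Q.submodule ∧
      LinearMap.ker c ⊓ W = R.submodule ∧
      ∀ v ∈ W, MvPolynomial.eval v G = a v * b v * c v

/-- One step of the construction: from the pairs `P, P'` and `Q, Q'` one obtains
`S = PQ ∧ P'Q'` and `S' = PQ' ∧ P'Q`, all lines and intersection points being well defined. -/
structure SchroeterStep (P P' Q Q' S S' : RPoint) : Prop where
  ne₁ : P ≠ Q
  ne₂ : P' ≠ Q'
  ne₃ : P ≠ Q'
  ne₄ : P' ≠ Q
  lines_ne : lineThrough P Q ≠ lineThrough P' Q'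
  lines_ne' : lineThrough P Q' ≠ lineThrough P' Q
  eq : S = wedge (lineThrough P Q) (lineThrough P' Q')
  eq' : S' = wedge (lineThrough P Q') (lineThrough P' Q)

/-- The pairs of Schroeter points generated from the three pairs `A, A'`, `B, B'`, `C, C'`:
the smallest family of pairs that contains these three and is closed under the steps of the
construction. -/
inductive IsSchroeterPair (A A' B B' C C' : RPoint) : RPoint → RPoint → Prop
  | pairA : IsSchroeterPair A A' B B' C C' A A'
  | pairB : IsSchroeterPair A A' B B' C C' B B'
  | pairC : IsSchroeterPair A A' B B' C C' C C'
  | step {P P' Q Q' S S' : RPoint} :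
      IsSchroeterPair A A' B B' C C' P P' → IsSchroeterPair A A' B B' C C' Q Q' →
      SchroeterStep P P' Q Q' S S' → IsSchroeterPair A A' B B' C C' S S'

/-- No four points of the set `M` are collinear. -/
def NoFourCollinear (M : Set RPoint) : Prop :=
  ∀ l : RLine, {P ∈ M | P.orthogonal l}.encard ≤ 3

/-- The exceptional triples: the tangents at two of the points `A`, `B`, `C` have the same further
intersection `R` with the cubic, and among the points other than `A`, `B`, `C` there are no two
distinct ones whose tangents also have further intersection `R`. -/
def IsExceptional (G : MvPolynomial (Fin 3) ℝ) (A B C : RPoint) : Prop :=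
  ∃ P ∈ ({A, B, C} : Set RPoint), ∃ Q ∈ ({A, B, C} : Set RPoint), P ≠ Q ∧
    ∃ R, IsThirdPoint G P P R ∧ IsThirdPoint G Q Q R ∧
      ¬ ∃ X Y : RPoint, X ≠ Y ∧
        X ∉ ({A, B, C} : Set RPoint) ∧ Y ∉ ({A, B, C} : Set RPoint) ∧
        IsThirdPoint G X X R ∧ IsThirdPoint G Y Y R

end

/-! In terms of the group law, P # Q = k − P − Q for a constant k, so the translation σ by a point
of order two satisfies σP # σQ = P # Q and σ(P # Q) = P # σQ. Take the barred points to be σA, σB,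
σC. When a step applies to the pairs P, σP and Q, σQ, its first two lines meet in P # Q and the
other two in P # σQ = σ(P # Q). Pairs of the form P, σP thus reproduce themselves, and all Schroeter
points stay on the cubic (`schroeterPair_of_translation`).

The group law is never constructed. If A ≠ X have the same residual tangential point R = A # A = X #
X, then P ↦ (P # A) # X plays the role of the translation by X − A. For P ≠ Q its invariance
property is a computation in one of two normal forms: a triangular one with vertices A, X, R
(`translation_triangular`), and a Weierstrass form when A is a flex (`translation_weierstrass`). The
case P = Q and the involution property then follow formally (`IsTwoTranslation.of_distinct`). A
suitable X exists because the tangents from R, apart from the one at A, are governed by a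
discriminant of degree three, which has a real root (`exists_ne_third_self_eq`).

For a non-exceptional triple, σ must not map one of A, B, C to another. If it maps P to Q, then P #
P = Q # Q, and there are two further points X, Y with the same residual point. The translations
taking P to X and to Y cannot both be bad: each would have to exchange Q with the third given point,
which forces X = Y (`exists_twoTranslation_avoiding`). The six points are then distinct, and the
remaining claims hold because a line meets the cubic in at most three points. -/

namespace SchroeterCubic

open MvPolynomial

/-! ### Polarization of ternary cubic forms -/

/-- The derivative of the polynomial `G` at `u` in the direction `v`. -/
noncomputable def dirDeriv {K : Type*} [CommRing K] (G : MvPolynomial (Fin 3) K)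
    (u v : Fin 3 → K) : K :=
  ∑ i, eval u (pderiv i G) * v i

/-- The fully polarized form of a cubic, with `polar G u u u = 6 G(u)`. -/
noncomputable def polar {K : Type*} [CommRing K] (G : MvPolynomial (Fin 3) K)
    (u v w : Fin 3 → K) : K :=
  eval (u + v + w) G - eval (u + v) G - eval (v + w) G - eval (u + w) G
    + eval u G + eval v G + eval w G

/-- Peeling off one variable at a time writes each monomial of degree three as a product of three
variables. Identities linear in the form need only be checked there. -/
theorem cubic_induction {K : Type*} [CommRing K] {p : MvPolynomial (Fin 3) K → Prop}
    (zero : p 0) (add : ∀ F H, p F → p H → p (F + H))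
    (mon : ∀ r i j k, p (C r * X i * X j * X k))
    {G : MvPolynomial (Fin 3) K} (hG : G.IsHomogeneous 3) : p G := by
  have step : ∀ (d : Fin 3 →₀ ℕ) (n : ℕ), d.degree = n + 1 →
      ∃ i d', d = Finsupp.single i 1 + d' ∧ d'.degree = n := by
    intro d n hd
    obtain ⟨i, hi⟩ : ∃ i, d i ≠ 0 := by
      by_contra! h
      have : d = 0 := Finsupp.ext h
      simp [this] at hd
    have hle : Finsupp.single i 1 ≤ d := by
      rw [Finsupp.single_le_iff]; omega
    refine ⟨i, d - Finsupp.single i 1, (add_tsub_cancel_of_le hle).symm, ?_⟩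
    have h := congrArg Finsupp.degree (add_tsub_cancel_of_le hle)
    rw [map_add, Finsupp.degree_single, hd] at h
    omega
  rw [← G.support_sum_monomial_coeff]
  refine Finset.sum_induction _ p add zero fun d hd => ?_
  have hdeg : d.degree = 3 := by
    exact (DFunLike.congr_fun Finsupp.degree_eq_weight_one d).trans (hG (mem_support_iff.mp hd))
  obtain ⟨i, d₁, rfl, h₁⟩ := step d 2 hdeg
  obtain ⟨j, d₂, rfl, h₂⟩ := step d₁ 1 h₁
  obtain ⟨k, d₃, rfl, h₃⟩ := step d₂ 0 h₂
  obtain rfl : d₃ = 0 := (Finsupp.degree_eq_zero_iff d₃).mp h₃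
  set r := coeff _ G
  have : monomial (Finsupp.single i 1 + (Finsupp.single j 1 + (Finsupp.single k 1 + 0))) r
      = C r * X i * X j * X k := by
    simp only [X, C_apply, monomial_mul, mul_one, add_zero, zero_add, add_assoc]
  rw [this]
  exact mon r i j k

section Expand

variable {K : Type*} [CommRing K]

theorem dirDeriv_add_left (F H : MvPolynomial (Fin 3) K) (u v : Fin 3 → K) :
    dirDeriv (F + H) u v = dirDeriv F u v + dirDeriv H u v := by
  simp [dirDeriv, add_mul, Finset.sum_add_distrib]

theorem polar_add_left (F H : MvPolynomial (Fin 3) K) (u v w : Fin 3 → K) :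
    polar (F + H) u v w = polar F u v w + polar H u v w := by
  simp only [polar, map_add]; ring

theorem dirDeriv_monomial (r : K) (i j k : Fin 3) (u v : Fin 3 → K) :
    dirDeriv (C r * X i * X j * X k) u v =
      r * (v i * u j * u k + u i * v j * u k + u i * u j * v k) := by
  simp only [dirDeriv, Derivation.leibniz, pderiv_C, pderiv_X, smul_eq_mul, map_add, map_mul,
    eval_X, eval_C, map_zero, Pi.single_apply, Fin.sum_univ_three]
  fin_cases i <;> fin_cases j <;> fin_cases k <;> simp <;> ring

theorem polar_monomial (r : K) (i j k : Fin 3) (u v w : Fin 3 → K) :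
    polar (C r * X i * X j * X k) u v w =
      r * (u i * v j * w k + u i * w j * v k + v i * u j * w k + v i * w j * u k
        + w i * u j * v k + w i * v j * u k) := by
  simp [polar]; ring

variable {G : MvPolynomial (Fin 3) K}

theorem dirDeriv_add (G : MvPolynomial (Fin 3) K) (u v w : Fin 3 → K) :
    dirDeriv G u (v + w) = dirDeriv G u v + dirDeriv G u w := by
  simp [dirDeriv, mul_add, Finset.sum_add_distrib]

theorem dirDeriv_smul (G : MvPolynomial (Fin 3) K) (t : K) (u v : Fin 3 → K) :
    dirDeriv G u (t • v) = t * dirDeriv G u v := by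
  simp only [dirDeriv, Finset.mul_sum, Pi.smul_apply, smul_eq_mul]
  exact Finset.sum_congr rfl fun i _ => by ring

/-- This gives the coefficients of the cubic in an arbitrary basis, so that normal forms can be read
off by choosing vectors. -/
theorem eval_comb (hG : G.IsHomogeneous 3) (u v w : Fin 3 → K) (x y z : K) :
    eval (x • u + y • v + z • w) G = eval u G * x ^ 3 + eval v G * y ^ 3 + eval w G * z ^ 3
      + dirDeriv G u v * x ^ 2 * y + dirDeriv G u w * x ^ 2 * z + dirDeriv G v u * x * y ^ 2
      + dirDeriv G v w * y ^ 2 * z + dirDeriv G w u * x * z ^ 2 + dirDeriv G w v * y * z ^ 2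
      + polar G u v w * x * y * z := by
  refine cubic_induction (p := fun G => eval (x • u + y • v + z • w) G =
      eval u G * x ^ 3 + eval v G * y ^ 3 + eval w G * z ^ 3
      + dirDeriv G u v * x ^ 2 * y + dirDeriv G u w * x ^ 2 * z + dirDeriv G v u * x * y ^ 2
      + dirDeriv G v w * y ^ 2 * z + dirDeriv G w u * x * z ^ 2 + dirDeriv G w v * y * z ^ 2
      + polar G u v w * x * y * z) ?_ ?_ ?_ hG
  · simp [dirDeriv, polar]
  · intro F H hF hH
    simp only [dirDeriv_add_left, polar_add_left, map_add, hF, hH]; ring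
  · intro r i j k
    simp only [dirDeriv_monomial, polar_monomial, map_mul, eval_C, eval_X, Pi.add_apply,
      Pi.smul_apply, smul_eq_mul]
    ring

theorem dirDeriv_comb (hG : G.IsHomogeneous 3) (u v w : Fin 3 → K) (x y : K) :
    dirDeriv G (x • u + y • v) w =
      dirDeriv G u w * x ^ 2 + polar G u v w * x * y + dirDeriv G v w * y ^ 2 := by
  refine cubic_induction (p := fun G => dirDeriv G (x • u + y • v) w =
      dirDeriv G u w * x ^ 2 + polar G u v w * x * y + dirDeriv G v w * y ^ 2) ?_ ?_ ?_ hG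
  · simp [dirDeriv, polar]
  · intro F H hF hH
    simp only [dirDeriv_add_left, polar_add_left, hF, hH]; ring
  · intro r i j k
    simp only [dirDeriv_monomial, polar_monomial, Pi.add_apply, Pi.smul_apply, smul_eq_mul]
    ring

theorem dirDeriv_self (hG : G.IsHomogeneous 3) (u : Fin 3 → K) :
    dirDeriv G u u = 3 * eval u G := by
  refine cubic_induction (p := fun G => dirDeriv G u u = 3 * eval u G) ?_ ?_ ?_ hG
  · simp [dirDeriv]
  · intro F H hF hH
    simp only [dirDeriv_add_left, map_add, hF, hH]; ring
  · intro r i j k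
    simp only [dirDeriv_monomial, map_mul, eval_C, eval_X]
    ring

theorem polar_self (hG : G.IsHomogeneous 3) (u v : Fin 3 → K) :
    polar G u v u = 2 * dirDeriv G u v := by
  refine cubic_induction (p := fun G => polar G u v u = 2 * dirDeriv G u v) ?_ ?_ ?_ hG
  · simp [dirDeriv, polar]
  · intro F H hF hH
    simp only [dirDeriv_add_left, polar_add_left, hF, hH]; ring
  · intro r i j k
    simp only [dirDeriv_monomial, polar_monomial]
    ring

theorem eval_comb_two (hG : G.IsHomogeneous 3) (u v : Fin 3 → K) (x y : K) :
    eval (x • u + y • v) G = eval u G * x ^ 3 + eval v G * y ^ 3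
      + dirDeriv G u v * x ^ 2 * y + dirDeriv G v u * x * y ^ 2 := by
  have := eval_comb hG u v 0 x y 0
  simpa using this

theorem eval_smul' (hG : G.IsHomogeneous 3) (u : Fin 3 → K) (x : K) :
    eval (x • u) G = x ^ 3 * eval u G := by
  have := eval_comb hG u 0 0 x 0 0
  simpa [mul_comm] using this

end Expand

/-! ### Consequences of smoothness -/

theorem aeval_ofReal (F : MvPolynomial (Fin 3) ℝ) (x : Fin 3 → ℝ) :
    aeval (fun i => (x i : ℂ)) F = ((eval x F : ℝ) : ℂ) := by
  exact aeval_algebraMap_apply ℂ x F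

/-- A smooth cubic contains no line. -/
theorem dirDeriv_ne_zero_or {G : MvPolynomial (Fin 3) ℝ} (hG : IsNonsingularCubic G)
    {u v : Fin 3 → ℝ} (huv : LinearIndependent ℝ ![u, v])
    (hu : eval u G = 0) (hv : eval v G = 0) : dirDeriv G u v ≠ 0 ∨ dirDeriv G v u ≠ 0 := by
  by_contra! h
  obtain ⟨h₁, h₂⟩ := h
  set w : Fin 3 → ℝ := crossProduct u v with hw
  let Gc : MvPolynomial (Fin 3) ℂ := map (algebraMap ℝ ℂ) G
  have hGc : Gc.IsHomogeneous 3 := hG.1.map _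
  let c : (Fin 3 → ℝ) → (Fin 3 → ℂ) := fun x i => (x i : ℂ)
  have hev : ∀ (F : MvPolynomial (Fin 3) ℝ) x,
      eval (c x) (map (algebraMap ℝ ℂ) F) = (eval x F : ℝ) := by
    intro F x
    rw [eval_map, ← aeval_def]
    exact aeval_ofReal F x
  have hD : ∀ x y, dirDeriv Gc (c x) (c y) = (dirDeriv G x y : ℝ) := by
    intro x y
    simp only [dirDeriv, Gc, pderiv_map, hev]
    push_cast
    rfl
  -- If the form vanishes identically on the line, its derivatives along the line vanish there as
  -- well. The derivative in the transversal direction `w` is a binary quadratic form on the line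
  -- and has a complex zero, which is a singular point of the cubic.
  obtain ⟨s, t, hst, hq⟩ : ∃ s t : ℂ, (s ≠ 0 ∨ t ≠ 0) ∧
      dirDeriv Gc (s • c u + t • c v) (c w) = 0 := by
    simp only [dirDeriv_comb hGc]
    set p := dirDeriv Gc (c u) (c w)
    set q := polar Gc (c u) (c v) (c w)
    set r := dirDeriv Gc (c v) (c w)
    by_cases hp : p = 0
    · exact ⟨1, 0, by simp, by simp [hp]⟩
    · obtain ⟨d, hd⟩ := IsAlgClosed.exists_pow_nat_eq (q ^ 2 - 4 * p * r) (n := 2) (by norm_num)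
      refine ⟨(d - q) / (2 * p), 1, by simp, ?_⟩
      field_simp
      linear_combination hd
  set z := s • c u + t • c v with hz
  have hdet : (Matrix.of ![u, v, w]).det ≠ 0 := by
    have h0 : w ≠ 0 := crossProduct_ne_zero_iff_linearIndependent.mpr huv
    have e : (Matrix.of ![u, v, w]).det = w ⬝ᵥ w := by
      change Matrix.det ![u, v, w] = _
      rw [← triple_product_eq_det, triple_product_permutation, triple_product_permutation]
    rw [e]
    exact fun h => h0 (dotProduct_self_eq_zero.mp h)
  have hdc : ((Matrix.of ![u, v, w]).map (algebraMap ℝ ℂ)).det ≠ 0 := by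
    rw [← RingHom.mapMatrix_apply, ← RingHom.map_det]
    simpa using hdet
  have hz0 : z ≠ 0 := by
    intro h
    have h3 := Matrix.eq_zero_of_vecMul_eq_zero hdc (v := ![s, t, 0]) (by
      rw [← h]
      ext k
      simp [Matrix.vecMul, dotProduct, Fin.sum_univ_three, hz, c])
    have e0 := congrFun h3 0
    have e1 := congrFun h3 1
    simp at e0 e1
    simp [e0, e1] at hst
  have hzu : dirDeriv Gc z (c u) = 0 := by
    rw [dirDeriv_comb hGc, polar_self hGc, dirDeriv_self hGc, hev, hD, hD, hu, h₁, h₂]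
    simp
  have hzv : dirDeriv Gc z (c v) = 0 := by
    rw [hz, add_comm, dirDeriv_comb hGc, polar_self hGc, dirDeriv_self hGc, hev, hD, hD, hv, h₁, h₂]
    simp
  have hzG : eval z Gc = 0 := by
    rw [eval_comb_two hGc, hev, hev, hD, hD, hu, hv, h₁, h₂]
    simp
  obtain ⟨i, hi⟩ := hG.2 z hz0 (by rw [aeval_def, ← eval_map]; exact hzG)
  refine hi ?_
  have := Matrix.eq_zero_of_mulVec_eq_zero hdc (v := fun i => aeval z (pderiv i G)) ?_
  · exact congrFun this i
  · have key : ∀ x : Fin 3 → ℝ, ∑ j, (x j : ℂ) * aeval z (pderiv j G) = dirDeriv Gc z (c x) := by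
      intro x
      simp only [dirDeriv, Gc, pderiv_map, aeval_def, eval_map]
      exact Finset.sum_congr rfl fun i _ => mul_comm _ _
    ext k
    simp only [Matrix.mulVec, dotProduct, Matrix.map_apply, Complex.coe_algebraMap]
    fin_cases k
    · exact (key u).trans hzu
    · exact (key v).trans hzv
    · exact (key w).trans hq

theorem exists_dirDeriv_ne_zero {G : MvPolynomial (Fin 3) ℝ} (hG : IsNonsingularCubic G)
    {u : Fin 3 → ℝ} (hu0 : u ≠ 0) (hu : eval u G = 0) : ∃ v, dirDeriv G u v ≠ 0 := by
  obtain ⟨i, hi⟩ := hG.2 (fun i => (u i : ℂ))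
    (fun h => hu0 (funext fun i => by simpa using congrFun h i)) (by rw [aeval_ofReal, hu]; simp)
  refine ⟨Pi.single i 1, ?_⟩
  rw [aeval_ofReal] at hi
  simpa [dirDeriv, Pi.single_apply] using hi

/-! ### Linear algebra of points and lines -/

theorem mk_eq_mk_of_smul {u v : Fin 3 → ℝ} (hu : u ≠ 0) (hv : v ≠ 0) {k : ℝ} (h : u = k • v) :
    Projectivization.mk ℝ u hu = Projectivization.mk ℝ v hv :=
  (Projectivization.mk_eq_mk_iff' ℝ u v hu hv).mpr ⟨k, h.symm⟩

theorem linearIndependent_of_mk_ne {u v : Fin 3 → ℝ} (hu : u ≠ 0) (hv : v ≠ 0)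
    (h : Projectivization.mk ℝ u hu ≠ Projectivization.mk ℝ v hv) :
    LinearIndependent ℝ ![u, v] := by
  rw [← crossProduct_ne_zero_iff_linearIndependent]
  exact fun h0 => h ((Projectivization.mk_eq_mk_iff_crossProduct_eq_zero hu hv).mpr h0)

theorem mk_ne_of_linearIndependent {u v : Fin 3 → ℝ} (hu : u ≠ 0) (hv : v ≠ 0)
    (h : LinearIndependent ℝ ![u, v]) :
    Projectivization.mk ℝ u hu ≠ Projectivization.mk ℝ v hv := by
  rw [← crossProduct_ne_zero_iff_linearIndependent] at h
  exact fun h0 => h ((Projectivization.mk_eq_mk_iff_crossProduct_eq_zero hu hv).mp h0)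

theorem ne_zero_of_pair {u v : Fin 3 → ℝ} (h : LinearIndependent ℝ ![u, v]) : u ≠ 0 ∧ v ≠ 0 :=
  ⟨h.ne_zero 0, h.ne_zero 1⟩

theorem mk_mem_cubicCurve {G : MvPolynomial (Fin 3) ℝ} (hG : G.IsHomogeneous 3)
    {u : Fin 3 → ℝ} (hu : u ≠ 0) :
    Projectivization.mk ℝ u hu ∈ cubicCurve G ↔ eval u G = 0 := by
  obtain ⟨a, ha⟩ := Projectivization.exists_smul_eq_mk_rep ℝ u hu
  have ha' : (a : ℝ) • u = (Projectivization.mk ℝ u hu).rep := ha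
  simp only [cubicCurve, Set.mem_ofPred_eq, ← ha', eval_smul' hG]
  simp

theorem finrank_span_pair_eq {p q : Fin 3 → ℝ} (h : LinearIndependent ℝ ![p, q]) :
    Module.finrank ℝ (Submodule.span ℝ {p, q}) = 2 := by
  have e : Set.range ![p, q] = {p, q} := by
    rw [Matrix.range_cons, Matrix.range_cons, Matrix.range_empty, Set.union_empty,
      Set.singleton_union]
  have := finrank_span_eq_card h
  rwa [e, Fintype.card_fin] at this

theorem span_pair_eq_of_mem {p q : Fin 3 → ℝ} (h : LinearIndependent ℝ ![p, q])
    {W : Submodule ℝ (Fin 3 → ℝ)} (hW : Module.finrank ℝ W = 2) (hp : p ∈ W) (hq : q ∈ W) :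
    Submodule.span ℝ {p, q} = W := by
  refine Submodule.eq_of_le_of_finrank_eq ?_ ((finrank_span_pair_eq h).trans hW.symm)
  rw [Submodule.span_le]
  rintro x (rfl | rfl) <;> assumption

theorem linearIndependent_triple_cross {p q : Fin 3 → ℝ} (h : LinearIndependent ℝ ![p, q]) :
    LinearIndependent ℝ ![p, q, crossProduct p q] := by
  have h0 : crossProduct p q ≠ 0 := crossProduct_ne_zero_iff_linearIndependent.mpr h
  have e : (Matrix.of ![p, q, crossProduct p q]).det =
      crossProduct p q ⬝ᵥ crossProduct p q := by
    change Matrix.det ![p, q, _] = _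
    rw [← triple_product_eq_det, triple_product_permutation, triple_product_permutation]
  refine Matrix.linearIndependent_rows_of_det_ne_zero (A := Matrix.of ![p, q, crossProduct p q]) ?_
  rw [e]
  exact fun h => h0 (dotProduct_self_eq_zero.mp h)

/-- Coordinates with respect to three linearly independent vectors. -/
theorem exists_coords {a b r : Fin 3 → ℝ} (h : LinearIndependent ℝ ![a, b, r]) (v : Fin 3 → ℝ) :
    ∃ x y z : ℝ, v = x • a + y • b + z • r := by
  let B := basisOfLinearIndependentOfCardEqFinrank h (by simp)
  refine ⟨B.repr v 0, B.repr v 1, B.repr v 2, ?_⟩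
  have := B.sum_repr v
  simpa [Fin.sum_univ_three, B, eq_comm] using this

theorem exists_dual {p q : Fin 3 → ℝ} (h : LinearIndependent ℝ ![p, q]) (x y : ℝ) :
    ∃ a : Module.Dual ℝ (Fin 3 → ℝ), a p = x ∧ a q = y := by
  let B := basisOfLinearIndependentOfCardEqFinrank (linearIndependent_triple_cross h) (by simp)
  refine ⟨B.constr ℝ ![x, y, 0], ?_, ?_⟩
  · have := B.constr_basis ℝ ![x, y, 0] 0
    simpa [B] using this
  · have := B.constr_basis ℝ ![x, y, 0] 1
    simpa [B] using this

theorem exists_smul_of_annihilated {x y s t : ℝ} (hxy : x ≠ 0 ∨ y ≠ 0) (h : s * x + t * y = 0) :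
    ∃ k, s = k * y ∧ t = -k * x := by
  rcases hxy with hx | hy
  · refine ⟨-t / x, ?_, by field_simp⟩
    field_simp; linarith
  · refine ⟨s / y, by field_simp, ?_⟩
    field_simp; linarith

theorem ker_inf_span_pair {p q : Fin 3 → ℝ} {a : Module.Dual ℝ (Fin 3 → ℝ)}
    (ha : a p ≠ 0 ∨ a q ≠ 0) {u : Fin 3 → ℝ} (hu0 : u ≠ 0)
    (hu : u ∈ Submodule.span ℝ {p, q}) (hau : a u = 0) :
    LinearMap.ker a ⊓ Submodule.span ℝ {p, q} = Submodule.span ℝ {u} := by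
  obtain ⟨s, t, rfl⟩ := Submodule.mem_span_pair.mp hu
  obtain ⟨k, rfl, rfl⟩ := exists_smul_of_annihilated ha (s := s) (t := t) (by simpa using hau)
  have hk : k ≠ 0 := by rintro rfl; simp at hu0
  apply le_antisymm
  · rintro x ⟨hx, hx'⟩
    obtain ⟨s', t', rfl⟩ := Submodule.mem_span_pair.mp hx'
    obtain ⟨l, rfl, rfl⟩ := exists_smul_of_annihilated ha (s := s') (t := t') (by simpa using hx)
    rw [Submodule.mem_span_singleton]
    refine ⟨l / k, ?_⟩
    simp only [smul_add, smul_smul]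
    congr 2 <;> field_simp
  · rw [Submodule.span_singleton_le_iff_mem]
    exact ⟨hau, hu⟩

/-! ### Third intersection points: coordinates, existence, uniqueness -/

/-- A factorization of the restriction of `G` to a line yields three points of the line. -/
theorem isThirdPoint_of_factorization {G : MvPolynomial (Fin 3) ℝ} {p q : Fin 3 → ℝ}
    (h : LinearIndependent ℝ ![p, q]) {a₁ a₂ b₁ b₂ c₁ c₂ : ℝ}
    (hG : ∀ s t : ℝ, eval (s • p + t • q) G =
      (s * a₁ + t * a₂) * (s * b₁ + t * b₂) * (s * c₁ + t * c₂))
    (ha : a₁ ≠ 0 ∨ a₂ ≠ 0) (hb : b₁ ≠ 0 ∨ b₂ ≠ 0) (hc : c₁ ≠ 0 ∨ c₂ ≠ 0)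
    {s₁ t₁ s₂ t₂ s₃ t₃ : ℝ} (h₁ : s₁ • p + t₁ • q ≠ 0) (h₂ : s₂ • p + t₂ • q ≠ 0)
    (h₃ : s₃ • p + t₃ • q ≠ 0) (e₁ : s₁ * a₁ + t₁ * a₂ = 0) (e₂ : s₂ * b₁ + t₂ * b₂ = 0)
    (e₃ : s₃ * c₁ + t₃ * c₂ = 0) :
    IsThirdPoint G (Projectivization.mk ℝ _ h₁) (Projectivization.mk ℝ _ h₂)
      (Projectivization.mk ℝ _ h₃) := by
  obtain ⟨a, rfl, rfl⟩ := exists_dual h a₁ a₂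
  obtain ⟨b, rfl, rfl⟩ := exists_dual h b₁ b₂
  obtain ⟨c, rfl, rfl⟩ := exists_dual h c₁ c₂
  have mem : ∀ s t : ℝ, s • p + t • q ∈ Submodule.span ℝ {p, q} := fun s t =>
    Submodule.mem_span_pair.mpr ⟨s, t, rfl⟩
  refine ⟨Submodule.span ℝ {p, q}, finrank_span_pair_eq h, a, b, c, ?_, ?_, ?_, ?_⟩
  · rw [Projectivization.submodule_mk]
    exact ker_inf_span_pair ha h₁ (mem _ _) (by simpa using e₁)
  · rw [Projectivization.submodule_mk]
    exact ker_inf_span_pair hb h₂ (mem _ _) (by simpa using e₂)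
  · rw [Projectivization.submodule_mk]
    exact ker_inf_span_pair hc h₃ (mem _ _) (by simpa using e₃)
  · intro v hv
    obtain ⟨s, t, rfl⟩ := Submodule.mem_span_pair.mp hv
    simpa using hG s t

variable {G : MvPolynomial (Fin 3) ℝ}

theorem isThirdPoint_swap {P Q R : RPoint} (h : IsThirdPoint G P Q R) : IsThirdPoint G Q P R := by
  obtain ⟨W, hW, a, b, c, ha, hb, hc, hf⟩ := h
  exact ⟨W, hW, b, a, c, hb, ha, hc, fun v hv => by rw [hf v hv]; ring⟩

theorem isThirdPoint_rotate {P Q R : RPoint} (h : IsThirdPoint G P Q R) :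
    IsThirdPoint G Q R P := by
  obtain ⟨W, hW, a, b, c, ha, hb, hc, hf⟩ := h
  exact ⟨W, hW, b, c, a, hb, hc, ha, fun v hv => by rw [hf v hv]; ring⟩

theorem isThirdPoint_mem_left {P Q R : RPoint} (h : IsThirdPoint G P Q R) :
    P ∈ cubicCurve G := by
  obtain ⟨W, hW, a, b, c, ha, hb, hc, hf⟩ := h
  have hP : P.rep ∈ LinearMap.ker a ⊓ W := by
    rw [ha, Projectivization.submodule_eq]
    exact Submodule.mem_span_singleton_self _
  change eval P.rep G = 0
  rw [hf _ hP.2, LinearMap.mem_ker.mp hP.1]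
  ring

/-- At zeros `u`, `v` of G the pure cubes drop out, and G(xu + yv) = xy(x·D_u v + y·D_v u). The last
factor, nonzero since the cubic contains no line, cuts out the third point. -/
theorem isThirdPoint_of_chord (hG : IsNonsingularCubic G) {u v : Fin 3 → ℝ}
    (huv : LinearIndependent ℝ ![u, v]) (hu : eval u G = 0) (hv : eval v G = 0)
    {s t : ℝ} (hw : s • u + t • v ≠ 0)
    (h : s * dirDeriv G u v + t * dirDeriv G v u = 0) :
    IsThirdPoint G (Projectivization.mk ℝ u (ne_zero_of_pair huv).1)
      (Projectivization.mk ℝ v (ne_zero_of_pair huv).2) (Projectivization.mk ℝ _ hw) := by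
  have := isThirdPoint_of_factorization (G := G) huv (a₁ := 0) (a₂ := 1) (b₁ := 1) (b₂ := 0)
    (c₁ := dirDeriv G u v) (c₂ := dirDeriv G v u) (s₁ := 1) (t₁ := 0) (s₂ := 0) (t₂ := 1)
    (s₃ := s) (t₃ := t) (fun x y => by rw [eval_comb_two hG.1, hu, hv]; ring)
    (by simp) (by simp) (dirDeriv_ne_zero_or hG huv hu hv)
    (by simpa using (ne_zero_of_pair huv).1) (by simpa using (ne_zero_of_pair huv).2) hw
    (by simp) (by simp) h
  simpa using this

/-- With `d` in the tangent direction, G(xu + yd) = y²(x·D_d u + y·G(d)): the point `u` counts twice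
and the linear factor gives the residual point. -/
theorem isThirdPoint_of_tangent (hG : IsNonsingularCubic G) {u d : Fin 3 → ℝ}
    (hud : LinearIndependent ℝ ![u, d]) (hu : eval u G = 0) (hd : dirDeriv G u d = 0)
    {s t : ℝ} (hw : s • u + t • d ≠ 0)
    (h : s * dirDeriv G d u + t * eval d G = 0) :
    IsThirdPoint G (Projectivization.mk ℝ u (ne_zero_of_pair hud).1)
      (Projectivization.mk ℝ u (ne_zero_of_pair hud).1) (Projectivization.mk ℝ _ hw) := by
  have hne : dirDeriv G d u ≠ 0 ∨ eval d G ≠ 0 := by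
    by_contra! h'
    rcases dirDeriv_ne_zero_or hG hud hu h'.2 with h | h
    exacts [h hd, h h'.1]
  have := isThirdPoint_of_factorization (G := G) hud (a₁ := 0) (a₂ := 1) (b₁ := 0) (b₂ := 1)
    (c₁ := dirDeriv G d u) (c₂ := eval d G) (s₁ := 1) (t₁ := 0) (s₂ := 1) (t₂ := 0)
    (s₃ := s) (t₃ := t) (fun x y => by rw [eval_comb_two hG.1, hu, hd]; ring)
    (by simp) (by simp) hne
    (by simpa using (ne_zero_of_pair hud).1) (by simpa using (ne_zero_of_pair hud).1) hw
    (by simp) (by simp) h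
  simpa using this

theorem chord_of_isThirdPoint (hG : IsNonsingularCubic G) {u v w : Fin 3 → ℝ}
    (hu : u ≠ 0) (hv : v ≠ 0) (hw : w ≠ 0) (huv : LinearIndependent ℝ ![u, v])
    (h : IsThirdPoint G (Projectivization.mk ℝ u hu) (Projectivization.mk ℝ v hv)
      (Projectivization.mk ℝ w hw)) :
    ∃ s t : ℝ, w = s • u + t • v ∧ s * dirDeriv G u v + t * dirDeriv G v u = 0 := by
  obtain ⟨W, hW, a, b, c, ha, hb, hc, hf⟩ := h
  rw [Projectivization.submodule_mk] at ha hb hc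
  have hu' : u ∈ LinearMap.ker a ⊓ W := ha ▸ Submodule.mem_span_singleton_self u
  have hv' : v ∈ LinearMap.ker b ⊓ W := hb ▸ Submodule.mem_span_singleton_self v
  have hw' : w ∈ LinearMap.ker c ⊓ W := hc ▸ Submodule.mem_span_singleton_self w
  have hau : a u = 0 := hu'.1
  have hbv : b v = 0 := hv'.1
  have hcw : c w = 0 := hw'.1
  have hspan := span_pair_eq_of_mem huv hW hu'.2 hv'.2
  have hGu : eval u G = 0 := by rw [hf u hu'.2, hau]; ring
  have hGv : eval v G = 0 := by rw [hf v hv'.2, hbv]; ring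
  obtain ⟨s, t, rfl⟩ := Submodule.mem_span_pair.mp (hspan ▸ hw'.2 : w ∈ Submodule.span ℝ {u, v})
  have key : ∀ x y : ℝ, dirDeriv G u v * x ^ 2 * y + dirDeriv G v u * x * y ^ 2 =
      (y * a v) * (x * b u) * (x * c u + y * c v) := by
    intro x y
    have h1 := eval_comb_two hG.1 u v x y
    rw [hf _ (W.add_mem (W.smul_mem x hu'.2) (W.smul_mem y hv'.2)), hGu, hGv] at h1
    simp only [map_add, map_smul, smul_eq_mul, hau, hbv] at h1
    linear_combination -h1
  -- Half the difference and half the sum of these two values isolate the coefficients D_u v and D_v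
  -- u, which are thus proportional to `c u` and `c v`.
  have k1 := key 1 1
  have k2 := key 1 (-1)
  simp only [map_add, map_smul, smul_eq_mul] at hcw
  refine ⟨s, t, rfl, ?_⟩
  linear_combination (s * (k1 - k2) + t * (k1 + k2)) / 2 + a v * b u * hcw

/-- The derivative at `u` as a linear form. -/
noncomputable def dirForm (G : MvPolynomial (Fin 3) ℝ) (u : Fin 3 → ℝ) :
    Module.Dual ℝ (Fin 3 → ℝ) where
  toFun := dirDeriv G u
  map_add' := dirDeriv_add G u
  map_smul' := fun t v => dirDeriv_smul G t u v

theorem finrank_ker_dirForm (hG : IsNonsingularCubic G) {u : Fin 3 → ℝ} (hu0 : u ≠ 0)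
    (hu : eval u G = 0) : Module.finrank ℝ (LinearMap.ker (dirForm G u)) = 2 := by
  obtain ⟨v, hv⟩ := exists_dirDeriv_ne_zero hG hu0 hu
  have hne : dirForm G u ≠ 0 := fun h => hv (by
    have : dirForm G u v = 0 := by rw [h]; rfl
    exact this)
  have := Module.Dual.finrank_ker_add_one_of_ne_zero hne
  simp at this
  omega

theorem exists_tangent_vector (hG : IsNonsingularCubic G) {u : Fin 3 → ℝ} (hu0 : u ≠ 0)
    (hu : eval u G = 0) : ∃ d, LinearIndependent ℝ ![u, d] ∧ dirDeriv G u d = 0 := by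
  have h2 := finrank_ker_dirForm hG hu0 hu
  have : ¬ LinearMap.ker (dirForm G u) ≤ Submodule.span ℝ {u} := by
    intro h
    have := Submodule.finrank_mono h
    rw [h2, finrank_span_singleton hu0] at this
    omega
  obtain ⟨d, hd, hd'⟩ := SetLike.not_le_iff_exists.mp this
  refine ⟨d, (LinearIndependent.pair_iff' hu0).mpr fun k hk => hd' ?_, hd⟩
  exact Submodule.mem_span_singleton.mpr ⟨k, hk⟩

theorem tangent_of_isThirdPoint (hG : IsNonsingularCubic G) {u w d : Fin 3 → ℝ}
    (hu : u ≠ 0) (hw : w ≠ 0) (hud : LinearIndependent ℝ ![u, d]) (hd : dirDeriv G u d = 0)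
    (h : IsThirdPoint G (Projectivization.mk ℝ u hu) (Projectivization.mk ℝ u hu)
      (Projectivization.mk ℝ w hw)) :
    ∃ s t : ℝ, w = s • u + t • d ∧ s * dirDeriv G d u + t * eval d G = 0 := by
  have hGu : eval u G = 0 := (mk_mem_cubicCurve hG.1 hu).mp (isThirdPoint_mem_left h)
  obtain ⟨W, hW, a, b, c, ha, hb, hc, hf⟩ := h
  rw [Projectivization.submodule_mk] at ha hb hc
  have hu' : u ∈ LinearMap.ker a ⊓ W := ha ▸ Submodule.mem_span_singleton_self u
  have hv' : u ∈ LinearMap.ker b ⊓ W := hb ▸ Submodule.mem_span_singleton_self u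
  have hw' : w ∈ LinearMap.ker c ⊓ W := hc ▸ Submodule.mem_span_singleton_self w
  have hau : a u = 0 := hu'.1
  have hbu : b u = 0 := hv'.1
  have hcw : c w = 0 := hw'.1
  have key : ∀ x ∈ W, ∀ t : ℝ, eval x G * t ^ 3 + dirDeriv G u x * t + dirDeriv G x u * t ^ 2 =
      (t * a x) * (t * b x) * (c u + t * c x) := by
    intro x hx t
    have h1 := eval_comb_two hG.1 u x 1 t
    rw [hf _ (W.add_mem (W.smul_mem 1 hu'.2) (W.smul_mem t hx)), hGu] at h1
    simp only [map_add, map_smul, smul_eq_mul, hau, hbu] at h1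
    linear_combination -h1
  have hle : W ≤ LinearMap.ker (dirForm G u) := by
    intro x hx
    -- The right side of `key` is divisible by t². The combination of the values at 1, −1 and 2 used
    -- below isolates the coefficient of t on the left, so D_u x = 0 and `W` lies in the tangent.
    have k1 := key x hx 1
    have k2 := key x hx (-1)
    have k3 := key x hx 2
    change dirDeriv G u x = 0
    linear_combination k1 - k2 / 3 - k3 / 6
  have hWk := Submodule.eq_of_le_of_finrank_eq hle (hW.trans (finrank_ker_dirForm hG hu hGu).symm)
  have hdW : d ∈ W := by rw [hWk]; exact hd
  have hspan := span_pair_eq_of_mem hud hW hu'.2 hdW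
  obtain ⟨s, t, rfl⟩ := Submodule.mem_span_pair.mp (hspan ▸ hw'.2 : w ∈ Submodule.span ℝ {u, d})
  have k1 := key d hdW 1
  have k2 := key d hdW (-1)
  simp only [map_add, map_smul, smul_eq_mul] at hcw
  refine ⟨s, t, rfl, ?_⟩
  linear_combination s * (k1 + k2) / 2 + t * (k1 - k2) / 2 + a d * b d * hcw - t * hd

/-- A nonzero binary linear form has only one projective zero; applied to the residual linear factor
this yields uniqueness of the third point. -/
theorem eq_of_annihilated {u v w w' : Fin 3 → ℝ} {x y : ℝ} (hxy : x ≠ 0 ∨ y ≠ 0)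
    (hw : w ≠ 0) (hw' : w' ≠ 0) (h : ∃ s t : ℝ, w = s • u + t • v ∧ s * x + t * y = 0)
    (h' : ∃ s t : ℝ, w' = s • u + t • v ∧ s * x + t * y = 0) :
    Projectivization.mk ℝ w hw = Projectivization.mk ℝ w' hw' := by
  obtain ⟨s, t, rfl, h⟩ := h
  obtain ⟨s', t', rfl, h'⟩ := h'
  obtain ⟨k, rfl, rfl⟩ := exists_smul_of_annihilated hxy h
  obtain ⟨l, rfl, rfl⟩ := exists_smul_of_annihilated hxy h'
  have hl : l ≠ 0 := by rintro rfl; simp at hw'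
  refine mk_eq_mk_of_smul hw hw' (k := k / l) ?_
  simp only [smul_add, smul_smul]
  congr 2 <;> field_simp

theorem isThirdPoint_unique (hG : IsNonsingularCubic G) {P Q R R' : RPoint}
    (h : IsThirdPoint G P Q R) (h' : IsThirdPoint G P Q R') : R = R' := by
  have hP := (isThirdPoint_mem_left h)
  have hQ := isThirdPoint_mem_left (isThirdPoint_swap h)
  induction P using Projectivization.ind with | h u hu =>
  induction Q using Projectivization.ind with | h v hv =>
  induction R using Projectivization.ind with | h w hw =>
  induction R' using Projectivization.ind with | h w' hw' =>
  rw [mk_mem_cubicCurve hG.1] at hP hQ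
  by_cases huv : Projectivization.mk ℝ u hu = Projectivization.mk ℝ v hv
  · rw [← huv] at h h'
    obtain ⟨d, hud, hd⟩ := exists_tangent_vector hG hu hP
    refine eq_of_annihilated (u := u) (v := d) (x := dirDeriv G d u) (y := eval d G) ?_ hw hw'
      (tangent_of_isThirdPoint hG hu hw hud hd h) (tangent_of_isThirdPoint hG hu hw' hud hd h')
    by_contra! h'
    rcases dirDeriv_ne_zero_or hG hud hP h'.2 with h | h
    exacts [h hd, h h'.1]
  · have huv := linearIndependent_of_mk_ne hu hv huv
    exact eq_of_annihilated (dirDeriv_ne_zero_or hG huv hP hQ) hw hw'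
      (chord_of_isThirdPoint hG hu hv hw huv h) (chord_of_isThirdPoint hG hu hv hw' huv h')

theorem comb_ne_zero {p q : Fin 3 → ℝ} (h : LinearIndependent ℝ ![p, q]) {s t : ℝ}
    (hst : s ≠ 0 ∨ t ≠ 0) : s • p + t • q ≠ 0 := by
  intro h0
  have := LinearIndependent.pair_iff.mp h s t h0
  tauto

theorem exists_isThirdPoint (hG : IsNonsingularCubic G) {P Q : RPoint}
    (hP : P ∈ cubicCurve G) (hQ : Q ∈ cubicCurve G) : ∃ R, IsThirdPoint G P Q R := by
  induction P using Projectivization.ind with | h u hu =>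
  induction Q using Projectivization.ind with | h v hv =>
  rw [mk_mem_cubicCurve hG.1] at hP hQ
  by_cases huv : Projectivization.mk ℝ u hu = Projectivization.mk ℝ v hv
  · rw [← huv]
    obtain ⟨d, hud, hd⟩ := exists_tangent_vector hG hu hP
    have hne : dirDeriv G d u ≠ 0 ∨ eval d G ≠ 0 := by
      by_contra! h'
      rcases dirDeriv_ne_zero_or hG hud hP h'.2 with h | h
      exacts [h hd, h h'.1]
    refine ⟨_, isThirdPoint_of_tangent hG hud hP hd (s := eval d G) (t := -dirDeriv G d u)
      (comb_ne_zero hud ?_) (by ring)⟩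
    rw [neg_ne_zero]; exact hne.symm
  · have huv := linearIndependent_of_mk_ne hu hv huv
    refine ⟨_, isThirdPoint_of_chord hG huv hP hQ (s := dirDeriv G v u) (t := -dirDeriv G u v)
      (comb_ne_zero huv ?_) (by ring)⟩
    rw [neg_ne_zero]; exact (dirDeriv_ne_zero_or hG huv hP hQ).symm

theorem isThirdPoint_orthogonal_lineThrough (hG : IsNonsingularCubic G) {P Q R : RPoint}
    (h : IsThirdPoint G P Q R) (hPQ : P ≠ Q) : R.orthogonal (lineThrough P Q) := by
  induction P using Projectivization.ind with | h u hu =>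
  induction Q using Projectivization.ind with | h v hv =>
  induction R using Projectivization.ind with | h w hw =>
  have huv := linearIndependent_of_mk_ne hu hv hPQ
  obtain ⟨s, t, rfl, -⟩ := chord_of_isThirdPoint hG hu hv hw huv h
  rw [lineThrough, Projectivization.cross_mk_of_ne hu hv hPQ, Projectivization.orthogonal_mk]
  simp [add_dotProduct, smul_dotProduct]

theorem exists_comb_of_orthogonal {u v w : Fin 3 → ℝ} (h : LinearIndependent ℝ ![u, v])
    (hw : w ⬝ᵥ crossProduct u v = 0) : ∃ s t : ℝ, w = s • u + t • v := by
  obtain ⟨x, y, z, rfl⟩ := exists_coords (linearIndependent_triple_cross h) w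
  have h0 : crossProduct u v ≠ 0 := crossProduct_ne_zero_iff_linearIndependent.mpr h
  have hz : z = 0 := by
    simpa [add_dotProduct, smul_dotProduct, h0] using hw
  exact ⟨x, y, by simp [hz]⟩

/-- On the line the cubic reads st(s·D_u v + t·D_v u), and the three factors give the three
alternatives. -/
theorem eq_or_isThirdPoint_of_orthogonal (hG : IsNonsingularCubic G) {P Q X : RPoint}
    (hP : P ∈ cubicCurve G) (hQ : Q ∈ cubicCurve G) (hX : X ∈ cubicCurve G) (hPQ : P ≠ Q)
    (h : X.orthogonal (lineThrough P Q)) : X = P ∨ X = Q ∨ IsThirdPoint G P Q X := by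
  induction P using Projectivization.ind with | h u hu =>
  induction Q using Projectivization.ind with | h v hv =>
  induction X using Projectivization.ind with | h w hw =>
  rw [mk_mem_cubicCurve hG.1] at hP hQ hX
  have huv := linearIndependent_of_mk_ne hu hv hPQ
  rw [lineThrough, Projectivization.cross_mk_of_ne hu hv hPQ, Projectivization.orthogonal_mk] at h
  obtain ⟨s, t, rfl⟩ := exists_comb_of_orthogonal huv h
  rw [eval_comb_two hG.1, hP, hQ] at hX
  have : s * (t * (s * dirDeriv G u v + t * dirDeriv G v u)) = 0 := by linear_combination hX
  rcases mul_eq_zero.mp this with rfl | h1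
  · exact Or.inr (Or.inl (mk_eq_mk_of_smul hw hv (k := t) (by simp)))
  rcases mul_eq_zero.mp h1 with rfl | h2
  · exact Or.inl (mk_eq_mk_of_smul hw hu (k := s) (by simp))
  · exact Or.inr (Or.inr (isThirdPoint_of_chord hG huv hP hQ hw h2))

/-! ### The chord operation on the curve -/

/-- The real points of the cubic as a type. -/
abbrev Curve (G : MvPolynomial (Fin 3) ℝ) : Type := {P : RPoint // P ∈ cubicCurve G}

/-- The third intersection point `P # Q`. -/
noncomputable def third (hG : IsNonsingularCubic G) (P Q : Curve G) : Curve G :=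
  ⟨(exists_isThirdPoint hG P.2 Q.2).choose,
    isThirdPoint_mem_left
      (isThirdPoint_rotate (isThirdPoint_rotate (exists_isThirdPoint hG P.2 Q.2).choose_spec))⟩

theorem third_spec (hG : IsNonsingularCubic G) (P Q : Curve G) :
    IsThirdPoint G P Q (third hG P Q) :=
  (exists_isThirdPoint hG P.2 Q.2).choose_spec

theorem third_eq_iff (hG : IsNonsingularCubic G) {P Q R : Curve G} :
    third hG P Q = R ↔ IsThirdPoint G P Q R :=
  ⟨fun h => h ▸ third_spec hG P Q,
    fun h => Subtype.ext (isThirdPoint_unique hG (third_spec hG P Q) h)⟩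

theorem third_comm (hG : IsNonsingularCubic G) (P Q : Curve G) :
    third hG P Q = third hG Q P :=
  (third_eq_iff hG).mpr (isThirdPoint_swap (third_spec hG Q P))

theorem third_third (hG : IsNonsingularCubic G) (P Q : Curve G) :
    third hG P (third hG P Q) = Q :=
  (third_eq_iff hG).mpr
    (isThirdPoint_swap (isThirdPoint_rotate (isThirdPoint_rotate (third_spec hG P Q))))

/-- The point of the curve with homogeneous coordinates `u`. -/
noncomputable def pt (hG : IsNonsingularCubic G) (u : Fin 3 → ℝ) (hu : u ≠ 0)
    (h : eval u G = 0) : Curve G :=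
  ⟨Projectivization.mk ℝ u hu, (mk_mem_cubicCurve hG.1 hu).mpr h⟩

theorem exists_pt (hG : IsNonsingularCubic G) (P : Curve G) : ∃ u hu h, P = pt hG u hu h := by
  obtain ⟨P, hP⟩ := P
  induction P using Projectivization.ind with | h u hu =>
  exact ⟨u, hu, (mk_mem_cubicCurve hG.1 hu).mp hP, rfl⟩

theorem pt_eq_of_smul (hG : IsNonsingularCubic G) {u v : Fin 3 → ℝ} {hu : u ≠ 0} {hv : v ≠ 0}
    {h : eval u G = 0} {h' : eval v G = 0} {k : ℝ} (e : u = k • v) :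
    pt hG u hu h = pt hG v hv h' :=
  Subtype.ext (mk_eq_mk_of_smul hu hv e)

theorem linearIndependent_of_pt_ne (hG : IsNonsingularCubic G) {u v : Fin 3 → ℝ} {hu : u ≠ 0}
    {hv : v ≠ 0} {h : eval u G = 0} {h' : eval v G = 0} (e : pt hG u hu h ≠ pt hG v hv h') :
    LinearIndependent ℝ ![u, v] :=
  linearIndependent_of_mk_ne hu hv fun e' => e (Subtype.ext e')

theorem pt_ne_of_linearIndependent (hG : IsNonsingularCubic G) {u v : Fin 3 → ℝ} {hu : u ≠ 0}
    {hv : v ≠ 0} {h : eval u G = 0} {h' : eval v G = 0} (e : LinearIndependent ℝ ![u, v]) :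
    pt hG u hu h ≠ pt hG v hv h' :=
  fun e' => mk_ne_of_linearIndependent hu hv e (congrArg Subtype.val e')

theorem third_pt_chord (hG : IsNonsingularCubic G) {u v w : Fin 3 → ℝ} {hu : u ≠ 0} {hv : v ≠ 0}
    {hw : w ≠ 0} {hGu : eval u G = 0} {hGv : eval v G = 0} {hGw : eval w G = 0}
    (huv : LinearIndependent ℝ ![u, v]) (s t : ℝ) (e : w = s • u + t • v)
    (h : s * dirDeriv G u v + t * dirDeriv G v u = 0) :
    third hG (pt hG u hu hGu) (pt hG v hv hGv) = pt hG w hw hGw := by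
  subst e
  exact (third_eq_iff hG).mpr (isThirdPoint_of_chord hG huv hGu hGv hw h)

theorem third_pt_tangent (hG : IsNonsingularCubic G) {u d w : Fin 3 → ℝ} {hu : u ≠ 0}
    {hw : w ≠ 0} {hGu : eval u G = 0} {hGw : eval w G = 0}
    (hud : LinearIndependent ℝ ![u, d]) (hd : dirDeriv G u d = 0) (s t : ℝ)
    (e : w = s • u + t • d) (h : s * dirDeriv G d u + t * eval d G = 0) :
    third hG (pt hG u hu hGu) (pt hG u hu hGu) = pt hG w hw hGw := by
  subst e
  exact (third_eq_iff hG).mpr (isThirdPoint_of_tangent hG hud hGu hd hw h)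

/-- Two chords have the same third point if the vectors representing it are proportional. -/
theorem third_pt_eq_third_pt (hG : IsNonsingularCubic G) {u v u' v' : Fin 3 → ℝ} {hu : u ≠ 0}
    {hv : v ≠ 0} {hu' : u' ≠ 0} {hv' : v' ≠ 0} {hGu : eval u G = 0} {hGv : eval v G = 0}
    {hGu' : eval u' G = 0} {hGv' : eval v' G = 0}
    (huv : LinearIndependent ℝ ![u, v]) (huv' : LinearIndependent ℝ ![u', v']) (k : ℝ)
    (h : dirDeriv G v' u' • u' + (-dirDeriv G u' v') • v' =
      k • (dirDeriv G v u • u + (-dirDeriv G u v) • v)) :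
    third hG (pt hG u' hu' hGu') (pt hG v' hv' hGv') =
      third hG (pt hG u hu hGu) (pt hG v hv hGv) := by
  have h0 : dirDeriv G v u • u + (-dirDeriv G u v) • v ≠ 0 :=
    comb_ne_zero huv (by rw [neg_ne_zero]; exact (dirDeriv_ne_zero_or hG huv hGu hGv).symm)
  have h0' : dirDeriv G v' u' • u' + (-dirDeriv G u' v') • v' ≠ 0 :=
    comb_ne_zero huv' (by rw [neg_ne_zero]; exact (dirDeriv_ne_zero_or hG huv' hGu' hGv').symm)
  have h1 := isThirdPoint_of_chord hG huv hGu hGv h0 (by ring)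
  have h2 := isThirdPoint_of_chord hG huv' hGu' hGv' h0' (by ring)
  rw [mk_eq_mk_of_smul h0' h0 h] at h2
  exact (third_eq_iff hG).mpr
    (by rwa [isThirdPoint_unique hG (third_spec hG (pt hG u hu hGu) (pt hG v hv hGv)) h1])

/-! ### Coordinates in an adapted basis -/

/-- The vector with coordinates `x, y, z` with respect to `a, b, r`. -/
noncomputable def vec (a b r : Fin 3 → ℝ) (x y z : ℝ) : Fin 3 → ℝ := x • a + y • b + z • r

theorem smul_vec (a b r : Fin 3 → ℝ) (k x y z : ℝ) :
    k • vec a b r x y z = vec a b r (k * x) (k * y) (k * z) := by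
  simp only [vec, smul_add, smul_smul]

theorem vec_add_vec (a b r : Fin 3 → ℝ) (x y z x' y' z' : ℝ) :
    vec a b r x y z + vec a b r x' y' z' = vec a b r (x + x') (y + y') (z + z') := by
  simp only [vec, add_smul]; abel

section Vec

variable {a b r : Fin 3 → ℝ}

theorem vec_eq_zero (h : LinearIndependent ℝ ![a, b, r]) {x y z : ℝ}
    (h0 : vec a b r x y z = 0) : x = 0 ∧ y = 0 ∧ z = 0 := by
  have := Fintype.linearIndependent_iff.mp h ![x, y, z]
    (by simpa [Fin.sum_univ_three, vec] using h0)
  exact ⟨this 0, this 1, this 2⟩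

theorem vec_ne_zero (h : LinearIndependent ℝ ![a, b, r]) {x y z : ℝ}
    (h0 : x ≠ 0 ∨ y ≠ 0 ∨ z ≠ 0) : vec a b r x y z ≠ 0 := by
  intro e
  have := vec_eq_zero h e
  tauto

theorem linearIndependent_vec (h : LinearIndependent ℝ ![a, b, r]) {x y z x' y' z' : ℝ}
    (h0 : x * y' - x' * y ≠ 0 ∨ x * z' - x' * z ≠ 0 ∨ y * z' - y' * z ≠ 0) :
    LinearIndependent ℝ ![vec a b r x y z, vec a b r x' y' z'] := by
  rw [LinearIndependent.pair_iff]
  intro s t hst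
  rw [smul_vec, smul_vec, vec_add_vec] at hst
  obtain ⟨h1, h2, h3⟩ := vec_eq_zero h hst
  by_contra hne
  have aux : ∀ {p q p' q' : ℝ}, s * p + t * p' = 0 → s * q + t * q' = 0 → p * q' - p' * q = 0 := by
    intro p q p' q' e1 e2
    by_cases hs : s = 0
    · have ht : t ≠ 0 := fun ht => hne ⟨hs, ht⟩
      subst hs
      have : p' = 0 := by simpa [ht] using e1
      have : q' = 0 := by simpa [ht] using e2
      simp [*]
    · apply mul_left_cancel₀ hs
      linear_combination q' * e1 - p' * e2
  rcases h0 with h0 | h0 | h0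
  exacts [h0 (aux h1 h2), h0 (aux h1 h3), h0 (aux h2 h3)]

end Vec

/-- Derivatives are recovered from values alone, so a normal form of the cubic determines them
without differentiating in the new coordinates. -/
theorem dirDeriv_eq (hG : IsNonsingularCubic G) (u v : Fin 3 → ℝ) :
    dirDeriv G u v = (eval (u + v) G - eval (u + (-1 : ℝ) • v) G) / 2 - eval v G := by
  have h1 := eval_comb_two hG.1 u v 1 1
  have h2 := eval_comb_two hG.1 u v 1 (-1)
  rw [one_smul] at h1 h2
  rw [one_smul] at h1
  rw [h1, h2]; ring

/-! ### The translation identity in normal form -/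

/-- Reduction of the translation identity to generic points, in an abstract chord structure. -/
theorem translation_of_generic {E : Type*} (op : E → E → E) (comm : ∀ P Q, op P Q = op Q P)
    (cancel : ∀ P Q, op P (op P Q) = Q) {A X : E} (gen : E → Prop)
    (hcl : ∀ P, P = A ∨ P = X ∨ P = op A A ∨ P = op A X ∨ gen P) (hR : op A A = op X X)
    (hswap : ∀ P, gen P → op (op P A) X = op (op P X) A)
    (hgen : ∀ P, gen P → gen (op (op P A) X))
    (hinv : ∀ P, gen P → op (op (op (op P A) X) A) X = P)
    (hRV : ∀ Q, gen Q → op (op A X) (op (op Q A) X) = op (op A A) Q)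
    (hgg : ∀ P Q, gen P → gen Q → P ≠ Q →
      op (op (op P A) X) (op (op Q A) X) = op P Q) :
    ∀ P Q, P ≠ Q → op (op (op P A) X) (op (op Q A) X) = op P Q := by
  have cancel' : ∀ P Q, op P (op Q P) = Q := fun P Q => by rw [comm Q P, cancel]
  have cancel₂ : ∀ P Q, op (op P Q) P = Q := fun P Q => by rw [comm, cancel]
  have cancel₃ : ∀ P Q, op (op P Q) Q = P := fun P Q => by rw [comm P Q, comm, cancel]
  -- Write σP = (P # A) # X, R = A # A and V = A # X. These four facts say that σ exchanges A with X
  -- and R with V.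
  have sA : op (op A A) X = X := by rw [hR, cancel₂]
  have sX : op (op X A) X = A := cancel₂ _ _
  have sR : op (op (op A A) A) X = op A X := by rw [cancel₂]
  have sV : op (op (op A X) A) X = op A A := by rw [cancel₂, hR]
  have sw : ∀ P, op (op P A) X = op (op P X) A := by
    intro P
    rcases hcl P with rfl | rfl | rfl | rfl | h
    · rw [sA, cancel₂]
    · rw [sX, ← hR, cancel₂]
    · rw [sR, hR, cancel₂, comm]
    · rw [sV, cancel₃]
    · exact hswap P h
  have lA : ∀ Q, op (op (op A A) X) (op (op Q A) X) = op A Q := fun Q => by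
    rw [sA, cancel', comm]
  have lX : ∀ Q, op (op (op X A) X) (op (op Q A) X) = op X Q := fun Q => by
    rw [sX, sw Q, cancel', comm]
  have lR : ∀ Q, gen Q → op (op (op (op A A) A) X) (op (op Q A) X) = op (op A A) Q :=
    fun Q h => by rw [sR, hRV Q h]
  -- The case of V is the case of R applied to σQ, since σ is an involution on generic points.
  have lV : ∀ Q, gen Q → op (op (op (op A X) A) X) (op (op Q A) X) = op (op A X) Q :=
    fun Q h => by rw [sV, ← hRV _ (hgen Q h), hinv Q h]
  intro P Q hne
  rcases hcl P with rfl | rfl | rfl | rfl | hP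
  · exact lA Q
  · exact lX Q
  · rcases hcl Q with rfl | rfl | rfl | rfl | hQ
    · rw [comm, lA, comm]
    · rw [comm, lX, comm]
    · exact absurd rfl hne
    · rw [sR, sV, comm]
    · exact lR Q hQ
  · rcases hcl Q with rfl | rfl | rfl | rfl | hQ
    · rw [comm, lA, comm]
    · rw [comm, lX, comm]
    · rw [sR, sV, comm]
    · exact absurd rfl hne
    · exact lV Q hQ
  · rcases hcl Q with rfl | rfl | rfl | rfl | hQ
    · rw [comm, lA, comm]
    · rw [comm, lX, comm]
    · rw [comm, lR P hP, comm]
    · rw [comm, lV P hP, comm]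
    · exact hgg P Q hP hQ hne

/-- The translation identity for a cubic in triangular normal form: `A = (1,0,0)`, `X = (0,1,0)`
and the tangents at these points meet at the point `(0,0,1)` of the cubic. -/
theorem translation_triangular (hG : IsNonsingularCubic G) {a b r : Fin 3 → ℝ}
    (hli : LinearIndependent ℝ ![a, b, r]) {κ α β e : ℝ} (hκ : κ ≠ 0) (hα : α ≠ 0) (hβ : β ≠ 0)
    (hF : ∀ x y z : ℝ, eval (vec a b r x y z) G =
      κ * (z ^ 2 * (α * x + β * y) + x * y * (x + y + e * z)))
    {A X : Curve G} (hA : ∃ h h', A = pt hG (vec a b r 1 0 0) h h')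
    (hX : ∃ h h', X = pt hG (vec a b r 0 1 0) h h') :
    ∀ P Q : Curve G, P ≠ Q →
      third hG (third hG (third hG P A) X) (third hG (third hG Q A) X) = third hG P Q := by
  have hD : ∀ x y z x' y' z' : ℝ, dirDeriv G (vec a b r x y z) (vec a b r x' y' z') =
      κ * ((α * z ^ 2 + 2 * x * y + y ^ 2 + e * y * z) * x'
        + (β * z ^ 2 + x ^ 2 + 2 * x * y + e * x * z) * y'
        + (2 * z * (α * x + β * y) + e * x * y) * z') := by
    intro x y z x' y' z'
    rw [dirDeriv_eq hG, smul_vec, vec_add_vec, vec_add_vec, hF, hF, hF]; ring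
  have hne : ∀ {x y z : ℝ}, (x ≠ 0 ∨ y ≠ 0 ∨ z ≠ 0) → vec a b r x y z ≠ 0 :=
    fun h => vec_ne_zero hli h
  have hR0 : vec a b r 0 0 1 ≠ 0 := hne (by simp)
  have hRG : eval (vec a b r 0 0 1) G = 0 := by rw [hF]; ring
  have hV0 : vec a b r 1 (-1) 0 ≠ 0 := hne (by simp)
  have hVG : eval (vec a b r 1 (-1) 0) G = 0 := by rw [hF]; ring
  obtain ⟨hA0, hAG, rfl⟩ := hA
  obtain ⟨hX0, hXG, rfl⟩ := hX
  have hAA : third hG (pt hG (vec a b r 1 0 0) hA0 hAG) (pt hG (vec a b r 1 0 0) hA0 hAG) =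
      pt hG (vec a b r 0 0 1) hR0 hRG := by
    refine third_pt_tangent hG (d := vec a b r 0 0 1)
      (linearIndependent_vec hli (by simp)) ?_ 0 1 (by simp) ?_
    · rw [hD]; ring
    · rw [hF]; ring
  have hXX : third hG (pt hG (vec a b r 0 1 0) hX0 hXG) (pt hG (vec a b r 0 1 0) hX0 hXG) =
      pt hG (vec a b r 0 0 1) hR0 hRG := by
    refine third_pt_tangent hG (d := vec a b r 0 0 1)
      (linearIndependent_vec hli (by simp)) ?_ 0 1 (by simp) ?_
    · rw [hD]; ring
    · rw [hF]; ring
  have hAX : third hG (pt hG (vec a b r 1 0 0) hA0 hAG) (pt hG (vec a b r 0 1 0) hX0 hXG) =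
      pt hG (vec a b r 1 (-1) 0) hV0 hVG := by
    refine third_pt_chord hG (linearIndependent_vec hli (by simp)) 1 (-1) ?_ ?_
    · rw [smul_vec, smul_vec, vec_add_vec]; norm_num
    · rw [hD, hD]; ring
  have gne : ∀ x y : ℝ, vec a b r x y 1 ≠ 0 := fun x y => hne (by simp)
  -- Off the coordinate triangle the equation, divided by xy at z = 1, is x + β/x + y + α/y + e = 0.
  -- With x' = β/x and y' = α/y it is symmetric: the chord to A replaces x by x', the chord to X
  -- replaces y by y', and σ does both.
  have gG : ∀ {x y x' y' : ℝ}, x * x' = β → y * y' = α → x + y + x' + y' + e = 0 →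
      eval (vec a b r x y 1) G = 0 := by
    intro x y x' y' h1 h2 h3
    rw [hF, ← h1, ← h2]
    linear_combination κ * x * y * h3
  have stepA : ∀ {x y x' y' : ℝ} (h1 : x * x' = β) (h2 : y * y' = α)
      (h3 : x + y + x' + y' + e = 0) (_ : y ≠ 0),
      third hG (pt hG (vec a b r x y 1) (gne x y) (gG h1 h2 h3))
        (pt hG (vec a b r 1 0 0) hA0 hAG) =
      pt hG (vec a b r x' y 1) (gne x' y)
        (gG ((mul_comm x' x).trans h1) h2 (by linear_combination h3)) := by
    intro x y x' y' h1 h2 h3 hy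
    refine third_pt_chord hG (linearIndependent_vec hli (by simp)) 1 (x' - x) ?_ ?_
    · rw [smul_vec, smul_vec, vec_add_vec]; congr 1 <;> ring
    · rw [hD, hD, ← h1, ← h2]
      linear_combination κ * y * h3
  have stepX : ∀ {x y x' y' : ℝ} (h1 : x * x' = β) (h2 : y * y' = α)
      (h3 : x + y + x' + y' + e = 0) (_ : x ≠ 0),
      third hG (pt hG (vec a b r x y 1) (gne x y) (gG h1 h2 h3))
        (pt hG (vec a b r 0 1 0) hX0 hXG) =
      pt hG (vec a b r x y' 1) (gne x y')
        (gG h1 ((mul_comm y' y).trans h2) (by linear_combination h3)) := by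
    intro x y x' y' h1 h2 h3 hx
    refine third_pt_chord hG (linearIndependent_vec hli (by simp)) 1 (y' - y) ?_ ?_
    · rw [smul_vec, smul_vec, vec_add_vec]; congr 1 <;> ring
    · rw [hD, hD, ← h1, ← h2]
      linear_combination κ * x * h3
  have nz : ∀ {x x' c : ℝ}, c ≠ 0 → x * x' = c → x ≠ 0 ∧ x' ≠ 0 := by
    rintro x x' c hc rfl
    exact ⟨left_ne_zero_of_mul hc, right_ne_zero_of_mul hc⟩
  have hσ : ∀ {x y x' y' : ℝ} (h1 : x * x' = β) (h2 : y * y' = α)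
      (h3 : x + y + x' + y' + e = 0),
      third hG (third hG (pt hG (vec a b r x y 1) (gne x y) (gG h1 h2 h3))
        (pt hG (vec a b r 1 0 0) hA0 hAG)) (pt hG (vec a b r 0 1 0) hX0 hXG) =
      pt hG (vec a b r x' y' 1) (gne x' y') (gG ((mul_comm x' x).trans h1)
        ((mul_comm y' y).trans h2) (by linear_combination h3)) := by
    intro x y x' y' h1 h2 h3
    rw [stepA h1 h2 h3 (nz hα h2).1, stepX (x := x') (x' := x) ((mul_comm x' x).trans h1) h2
      (by linear_combination h3) (nz hβ h1).2]
  have hσ' : ∀ {x y x' y' : ℝ} (h1 : x * x' = β) (h2 : y * y' = α)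
      (h3 : x + y + x' + y' + e = 0),
      third hG (third hG (pt hG (vec a b r x y 1) (gne x y) (gG h1 h2 h3))
        (pt hG (vec a b r 0 1 0) hX0 hXG)) (pt hG (vec a b r 1 0 0) hA0 hAG) =
      pt hG (vec a b r x' y' 1) (gne x' y') (gG ((mul_comm x' x).trans h1)
        ((mul_comm y' y).trans h2) (by linear_combination h3)) := by
    intro x y x' y' h1 h2 h3
    rw [stepX h1 h2 h3 (nz hβ h1).1, stepA (y := y') (y' := y) h1 ((mul_comm y' y).trans h2)
      (by linear_combination h3) (nz hα h2).2]
  refine translation_of_generic (third hG) (third_comm hG) (third_third hG)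
    (fun P => ∃ x y x' y' : ℝ, ∃ (h1 : x * x' = β) (h2 : y * y' = α)
      (h3 : x + y + x' + y' + e = 0), P = pt hG (vec a b r x y 1) (gne x y) (gG h1 h2 h3))
    ?_ ?_ ?_ ?_ ?_ ?_ ?_
  · intro P
    rw [hAA, hAX]
    obtain ⟨u, hu, hGu, rfl⟩ := exists_pt hG P
    obtain ⟨x, y, z, rfl⟩ := exists_coords hli u
    have hGu' := hF x y z
    rw [vec, hGu] at hGu'
    have hp : z ^ 2 * (α * x + β * y) + x * y * (x + y + e * z) = 0 := by
      simpa [hκ] using hGu'.symm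
    by_cases hz : z = 0
    · subst hz
      have : x * (y * (x + y)) = 0 := by linear_combination hp
      rcases mul_eq_zero.mp this with rfl | h
      · exact Or.inr (Or.inl (pt_eq_of_smul hG (k := y) (by simp [vec])))
      rcases mul_eq_zero.mp h with rfl | h
      · exact Or.inl (pt_eq_of_smul hG (k := x) (by simp [vec]))
      · obtain rfl : y = -x := by linarith
        exact Or.inr (Or.inr (Or.inr (Or.inl (pt_eq_of_smul hG (k := x) (by simp [vec])))))
    · by_cases hx : x = 0
      · subst hx
        have hy : y = 0 := by simpa [hz, hβ] using hp
        subst hy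
        exact Or.inr (Or.inr (Or.inl (pt_eq_of_smul hG (k := z) (by simp [vec]))))
      by_cases hy : y = 0
      · subst hy
        simp [hz, hα, hx] at hp
      refine Or.inr (Or.inr (Or.inr (Or.inr ⟨x / z, y / z, β * z / x, α * z / y, ?_, ?_, ?_, ?_⟩)))
      · field_simp
      · field_simp
      · field_simp
        linear_combination hp
      · refine pt_eq_of_smul hG (k := z) ?_
        rw [smul_vec, mul_div_cancel₀ _ hz, mul_div_cancel₀ _ hz, mul_one, vec]
  · rw [hAA, hXX]
  · rintro P ⟨x, y, x', y', h1, h2, h3, rfl⟩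
    rw [hσ h1 h2 h3, hσ' h1 h2 h3]
  · rintro P ⟨x, y, x', y', h1, h2, h3, rfl⟩
    exact ⟨x', y', x, y, (mul_comm x' x).trans h1, (mul_comm y' y).trans h2,
      by linear_combination h3, hσ h1 h2 h3⟩
  · rintro P ⟨x, y, x', y', h1, h2, h3, rfl⟩
    rw [hσ h1 h2 h3, hσ (x := x') (y := y') (x' := x) (y' := y) ((mul_comm x' x).trans h1)
      ((mul_comm y' y).trans h2) (by linear_combination h3)]
  · rintro Q ⟨x, y, x', y', h1, h2, h3, rfl⟩
    have hx := (nz hβ h1).1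
    have hy := (nz hα h2).1
    rw [hσ h1 h2 h3, hAA, hAX]
    have D1 : dirDeriv G (vec a b r 0 0 1) (vec a b r x y 1) = κ * (x * y * (x' + y')) := by
      rw [hD, ← h1, ← h2]; ring
    have D2 : dirDeriv G (vec a b r x y 1) (vec a b r 0 0 1) =
        κ * (x * y * (x' + y' - x - y)) := by
      rw [hD, ← h1, ← h2]; linear_combination κ * x * y * h3
    have D3 : dirDeriv G (vec a b r 1 (-1) 0) (vec a b r x' y' 1) = κ * (x + y) := by
      rw [hD]; linear_combination -κ * h3
    have D4 : dirDeriv G (vec a b r x' y' 1) (vec a b r 1 (-1) 0) = κ * (x' * y - x * y') := by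
      rw [hD, ← h1, ← h2]; linear_combination κ * (y' - x') * h3
    refine third_pt_eq_third_pt hG (linearIndependent_vec hli (by simp [hx]))
      (linearIndependent_vec hli (by simp)) (x * y)⁻¹ ?_
    rw [D1, D2, D3, D4]
    simp only [smul_vec, vec_add_vec]
    congr 1 <;> field_simp <;> ring
  · rintro P Q ⟨x, y, x', y', h1, h2, h3, rfl⟩ ⟨p, q, p', q', k1, k2, k3, rfl⟩ hPQ
    have hne' : pt hG (vec a b r x' y' 1) (gne x' y') (gG ((mul_comm x' x).trans h1)
        ((mul_comm y' y).trans h2) (by linear_combination h3)) ≠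
        pt hG (vec a b r p' q' 1) (gne p' q') (gG ((mul_comm p' p).trans k1)
        ((mul_comm q' q).trans k2) (by linear_combination k3)) := by
      intro he
      apply hPQ
      have h4 := hσ (x := x') (y := y') (x' := x) (y' := y)
        ((mul_comm x' x).trans h1) ((mul_comm y' y).trans h2) (by linear_combination h3)
      have k4 := hσ (x := p') (y := q') (x' := p) (y' := q)
        ((mul_comm p' p).trans k1) ((mul_comm q' q).trans k2) (by linear_combination k3)
      rw [he] at h4
      exact h4.symm.trans k4
    rw [hσ h1 h2 h3, hσ k1 k2 k3]
    -- Since xx' = β = pp', the ratios x'/p and p'/x coincide; likewise y'/q = q'/y. The parameters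
    -- s, t eliminate α and β and make the factor −st between the two residual vectors visible.
    obtain ⟨s, rfl⟩ : ∃ s, x' = p * s := ⟨x' / p, by field_simp [(nz hβ k1).1]⟩
    obtain ⟨t, rfl⟩ : ∃ t, y' = q * t := ⟨y' / q, by field_simp [(nz hα k2).1]⟩
    obtain rfl : p' = x * s := mul_left_cancel₀ (nz hβ k1).1 (by linear_combination k1 - h1)
    obtain rfl : q' = y * t := mul_left_cancel₀ (nz hα k2).1 (by linear_combination k2 - h2)
    refine third_pt_eq_third_pt hG (linearIndependent_of_pt_ne hG hPQ)
      (linearIndependent_of_pt_ne hG hne') (-(s * t)) ?_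
    have D1 : dirDeriv G (vec a b r x y 1) (vec a b r p q 1) =
        κ * (y * (x - p * s) * (p - x) + x * (y - q * t) * (q - y)) := by
      rw [hD, ← h1, ← h2]
      linear_combination κ * (y * p + x * q + x * y) * h3
    have D2 : dirDeriv G (vec a b r p q 1) (vec a b r x y 1) =
        -κ * (q * (p - x * s) * (p - x) + p * (q - y * t) * (q - y)) := by
      rw [hD, ← k1, ← k2]
      linear_combination κ * (q * x + p * y + p * q) * k3
    have D3 : dirDeriv G (vec a b r (p * s) (q * t) 1) (vec a b r (x * s) (y * t) 1) =
        κ * (s * t * (q * (x - p * s) * (p - x) + p * (y - q * t) * (q - y))) := by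
      rw [hD, ← h1, ← h2]
      linear_combination κ * (q * t * x * s + p * s * y * t + p * s * q * t) * h3
    have D4 : dirDeriv G (vec a b r (x * s) (y * t) 1) (vec a b r (p * s) (q * t) 1) =
        -κ * (s * t * (y * (p - x * s) * (p - x) + x * (q - y * t) * (q - y))) := by
      rw [hD, ← k1, ← k2]
      linear_combination κ * (y * t * p * s + x * s * q * t + x * s * y * t) * k3
    rw [D1, D2, D3, D4]
    simp only [smul_vec, vec_add_vec]
    congr 1
    -- Each coordinate identity holds modulo the difference of the two curve equations, in which `e`
    -- cancels.
    · linear_combination -κ * (s * t * x * p * (y + q) * (1 + s)) * (k3 - h3)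
    · linear_combination -κ * (s * t * y * q * (x + p) * (1 + t)) * (k3 - h3)
    · linear_combination -κ * (s * t * (x + p) * (y + q)) * (k3 - h3)

/-- The translation identity for a cubic in Weierstrass form `y²z = x³ + cx²z + exz²`, with the
flex `A = (0,1,0)` and the point `X = (0,0,1)` of order two. -/
theorem translation_weierstrass (hG : IsNonsingularCubic G) {a b r : Fin 3 → ℝ}
    (hli : LinearIndependent ℝ ![a, b, r]) {κ c e : ℝ} (hκ : κ ≠ 0) (he : e ≠ 0)
    (hF : ∀ x y z : ℝ, eval (vec a b r x y z) G =
      κ * (x ^ 3 + c * x ^ 2 * z + e * x * z ^ 2 - y ^ 2 * z))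
    {A X : Curve G} (hA : ∃ h h', A = pt hG (vec a b r 0 1 0) h h')
    (hX : ∃ h h', X = pt hG (vec a b r 0 0 1) h h') :
    ∀ P Q : Curve G, P ≠ Q →
      third hG (third hG (third hG P A) X) (third hG (third hG Q A) X) = third hG P Q := by
  have hD : ∀ x y z x' y' z' : ℝ, dirDeriv G (vec a b r x y z) (vec a b r x' y' z') =
      κ * ((3 * x ^ 2 + 2 * c * x * z + e * z ^ 2) * x' - 2 * y * z * y'
        + (c * x ^ 2 + 2 * e * x * z - y ^ 2) * z') := by
    intro x y z x' y' z'
    rw [dirDeriv_eq hG, smul_vec, vec_add_vec, vec_add_vec, hF, hF, hF]; ring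
  obtain ⟨hA0, hAG, rfl⟩ := hA
  obtain ⟨hX0, hXG, rfl⟩ := hX
  have hAA : third hG (pt hG (vec a b r 0 1 0) hA0 hAG) (pt hG (vec a b r 0 1 0) hA0 hAG) =
      pt hG (vec a b r 0 1 0) hA0 hAG := by
    refine third_pt_tangent hG (d := vec a b r 1 0 0)
      (linearIndependent_vec hli (by simp)) ?_ 1 0 (by simp) ?_
    · rw [hD]; ring
    · rw [hD]; ring
  have hXX : third hG (pt hG (vec a b r 0 0 1) hX0 hXG) (pt hG (vec a b r 0 0 1) hX0 hXG) =
      pt hG (vec a b r 0 1 0) hA0 hAG := by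
    refine third_pt_tangent hG (d := vec a b r 0 1 0)
      (linearIndependent_vec hli (by simp)) ?_ 0 1 (by simp) ?_
    · rw [hD]; ring
    · rw [hF]; ring
  have hAX : third hG (pt hG (vec a b r 0 1 0) hA0 hAG) (pt hG (vec a b r 0 0 1) hX0 hXG) =
      pt hG (vec a b r 0 0 1) hX0 hXG := by
    rw [← hXX, third_comm, third_third]
  have gne : ∀ x m : ℝ, vec a b r x (x * m) 1 ≠ 0 := fun x m => vec_ne_zero hli (by simp)
  -- With the slope m = y/x and x' = e/x the affine equation becomes m² = x + c + x'. The chord to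
  -- the flex A changes the sign of m; the chord to X, a line through the origin of fixed slope,
  -- exchanges x and x'.
  have gG : ∀ {x x' m : ℝ}, x * x' = e → m ^ 2 = x + c + x' →
      eval (vec a b r x (x * m) 1) G = 0 := by
    intro x x' m h1 h2
    rw [hF, ← h1]
    linear_combination -κ * x ^ 2 * h2
  have nz : ∀ {x x' : ℝ}, x * x' = e → x ≠ 0 ∧ x' ≠ 0 := by
    rintro x x' rfl
    exact ⟨left_ne_zero_of_mul he, right_ne_zero_of_mul he⟩
  have stepA : ∀ {x x' m : ℝ} (h1 : x * x' = e) (h2 : m ^ 2 = x + c + x'),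
      third hG (pt hG (vec a b r x (x * m) 1) (gne x m) (gG h1 h2))
        (pt hG (vec a b r 0 1 0) hA0 hAG) =
      pt hG (vec a b r x (x * -m) 1) (gne x (-m)) (gG h1 (by rw [neg_sq]; exact h2)) := by
    intro x x' m h1 h2
    refine third_pt_chord hG (linearIndependent_vec hli (by simp [(nz h1).1])) 1 (-2 * x * m)
      ?_ ?_
    · rw [smul_vec, smul_vec, vec_add_vec]; congr 1 <;> ring
    · rw [hD, hD]; ring
  have stepX : ∀ {x x' m : ℝ} (h1 : x * x' = e) (h2 : m ^ 2 = x + c + x'),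
      third hG (pt hG (vec a b r x (x * m) 1) (gne x m) (gG h1 h2))
        (pt hG (vec a b r 0 0 1) hX0 hXG) =
      pt hG (vec a b r x' (x' * m) 1) (gne x' m)
        (gG ((mul_comm x' x).trans h1) (by linear_combination h2)) := by
    intro x x' m h1 h2
    have hx := (nz h1).1
    refine third_pt_chord hG (linearIndependent_vec hli (by simp [hx])) (x' / x) (1 - x' / x)
      ?_ ?_
    · rw [smul_vec, smul_vec, vec_add_vec]; congr 1 <;> field_simp <;> ring
    · rw [hD, hD, ← h1]
      field_simp
      linear_combination -κ * x ^ 2 * x' * h2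
  have hσ : ∀ {x x' m : ℝ} (h1 : x * x' = e) (h2 : m ^ 2 = x + c + x'),
      third hG (third hG (pt hG (vec a b r x (x * m) 1) (gne x m) (gG h1 h2))
        (pt hG (vec a b r 0 1 0) hA0 hAG)) (pt hG (vec a b r 0 0 1) hX0 hXG) =
      pt hG (vec a b r x' (x' * -m) 1) (gne x' (-m))
        (gG ((mul_comm x' x).trans h1) (by linear_combination h2)) := by
    intro x x' m h1 h2
    rw [stepA h1 h2, stepX (m := -m) h1 (by linear_combination h2)]
  refine translation_of_generic (third hG) (third_comm hG) (third_third hG)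
    (fun P => ∃ x x' m : ℝ, ∃ (h1 : x * x' = e) (h2 : m ^ 2 = x + c + x'),
      P = pt hG (vec a b r x (x * m) 1) (gne x m) (gG h1 h2))
    ?_ ?_ ?_ ?_ ?_ ?_ ?_
  · intro P
    obtain ⟨u, hu, hGu, rfl⟩ := exists_pt hG P
    obtain ⟨x, y, z, rfl⟩ := exists_coords hli u
    have hGu' := hF x y z
    rw [vec, hGu] at hGu'
    have hp : x ^ 3 + c * x ^ 2 * z + e * x * z ^ 2 - y ^ 2 * z = 0 := by
      simpa [hκ] using hGu'.symm
    by_cases hz : z = 0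
    · subst hz
      have : x = 0 := by simpa using hp
      subst this
      exact Or.inl (pt_eq_of_smul hG (k := y) (by simp [vec]))
    · by_cases hx : x = 0
      · subst hx
        have : y = 0 := by simpa [hz] using hp
        subst this
        exact Or.inr (Or.inl (pt_eq_of_smul hG (k := z) (by simp [vec])))
      refine Or.inr (Or.inr (Or.inr (Or.inr ⟨x / z, e * z / x, y / x, ?_, ?_, ?_⟩)))
      · field_simp
      · field_simp
        linear_combination -hp
      · refine pt_eq_of_smul hG (k := z) ?_
        rw [smul_vec, mul_div_cancel₀ _ hz, mul_one, vec]
        congr 3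
        field_simp
  · rw [hAA, hXX]
  · rintro P ⟨x, x', m, h1, h2, rfl⟩
    rw [hσ h1 h2, stepX h1 h2,
      stepA (x := x') (x' := x) ((mul_comm x' x).trans h1) (by linear_combination h2)]
  · rintro P ⟨x, x', m, h1, h2, rfl⟩
    exact ⟨x', x, -m, (mul_comm x' x).trans h1, by linear_combination h2, hσ h1 h2⟩
  · rintro P ⟨x, x', m, h1, h2, rfl⟩
    rw [hσ h1 h2, hσ (x := x') (x' := x) (m := -m) ((mul_comm x' x).trans h1)
      (by linear_combination h2)]
    simp only [neg_neg]
  · rintro Q ⟨x, x', m, h1, h2, rfl⟩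
    rw [hσ h1 h2, hAA, hAX, third_comm, third_comm hG (pt hG (vec a b r 0 1 0) hA0 hAG),
      stepA h1 h2, stepX (x := x') (x' := x) (m := -m) ((mul_comm x' x).trans h1)
      (by linear_combination h2)]
  · rintro P Q ⟨x, x', m, h1, h2, rfl⟩ ⟨p, p', n, k1, k2, rfl⟩ hPQ
    have hne' : pt hG (vec a b r x' (x' * -m) 1) (gne x' (-m))
        (gG ((mul_comm x' x).trans h1) (by linear_combination h2)) ≠
        pt hG (vec a b r p' (p' * -n) 1) (gne p' (-n))
        (gG ((mul_comm p' p).trans k1) (by linear_combination k2)) := by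
      intro h
      apply hPQ
      have h4 := hσ (x := x') (x' := x) (m := -m)
        ((mul_comm x' x).trans h1) (by linear_combination h2)
      have k4 := hσ (x := p') (x' := p) (m := -n)
        ((mul_comm p' p).trans k1) (by linear_combination k2)
      rw [h] at h4
      simp only [neg_neg] at h4 k4
      exact h4.symm.trans k4
    rw [hσ h1 h2, hσ k1 k2]
    -- As in the triangular form, xx' = e = pp' makes the ratios x'/p and p'/x equal.
    obtain ⟨s, rfl⟩ : ∃ s, x' = p * s := ⟨x' / p, by field_simp [(nz k1).1]⟩
    obtain rfl : p' = x * s := mul_left_cancel₀ (nz k1).1 (by linear_combination k1 - h1)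
    refine third_pt_eq_third_pt hG (linearIndependent_of_pt_ne hG hPQ)
      (linearIndependent_of_pt_ne hG hne') (-s ^ 3) ?_
    have D1 : dirDeriv G (vec a b r x (x * m) 1) (vec a b r p (p * n) 1) =
        κ * (x * ((x - p * s) * (p - x) + 2 * m * p * (m - n))) := by
      rw [hD, ← h1]
      linear_combination -κ * (2 * x * p + x ^ 2) * h2
    have D2 : dirDeriv G (vec a b r p (p * n) 1) (vec a b r x (x * m) 1) =
        κ * (p * ((p - x * s) * (x - p) + 2 * n * x * (n - m))) := by
      rw [hD, ← k1]
      linear_combination -κ * (2 * x * p + p ^ 2) * k2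
    have D3 : dirDeriv G (vec a b r (p * s) (p * s * -m) 1) (vec a b r (x * s) (x * s * -n) 1) =
        κ * (p * s * ((p * s - x) * s * (x - p) + 2 * m * x * s * (m - n))) := by
      rw [hD, ← h1]
      linear_combination -κ * (2 * x * s * p * s + (p * s) ^ 2) * h2
    have D4 : dirDeriv G (vec a b r (x * s) (x * s * -n) 1) (vec a b r (p * s) (p * s * -m) 1) =
        κ * (x * s * ((x * s - p) * s * (p - x) + 2 * n * p * s * (n - m))) := by
      rw [hD, ← k1]
      linear_combination -κ * (2 * x * s * p * s + (x * s) ^ 2) * k2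
    rw [D1, D2, D3, D4]
    simp only [smul_vec, vec_add_vec]
    congr 1
    · linear_combination -2 * κ * x * p * s ^ 3 * (x + p) * (h2 - k2)
    · ring
    · linear_combination -2 * κ * x * p * s ^ 2 * (1 + s) * (h2 - k2)

/-! ### Reduction to the normal forms -/

theorem linearIndependent_of_vec {a b r : Fin 3 → ℝ}
    (h : ∀ x y z : ℝ, vec a b r x y z = 0 → x = 0 ∧ y = 0 ∧ z = 0) :
    LinearIndependent ℝ ![a, b, r] := by
  rw [Fintype.linearIndependent_iff]
  intro g hg
  obtain ⟨h1, h2, h3⟩ := h (g 0) (g 1) (g 2) (by simpa [Fin.sum_univ_three, vec] using hg)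
  intro i
  fin_cases i <;> assumption

theorem eval_vec (hG : IsNonsingularCubic G) (a b r : Fin 3 → ℝ) (x y z : ℝ) :
    eval (vec a b r x y z) G = eval a G * x ^ 3 + eval b G * y ^ 3 + eval r G * z ^ 3
      + dirDeriv G a b * x ^ 2 * y + dirDeriv G a r * x ^ 2 * z + dirDeriv G b a * x * y ^ 2
      + dirDeriv G b r * y ^ 2 * z + dirDeriv G r a * x * z ^ 2 + dirDeriv G r b * y * z ^ 2
      + polar G a b r * x * y * z :=
  eval_comb hG.1 a b r x y z

theorem dirDeriv_vec (G : MvPolynomial (Fin 3) ℝ) (u a b r : Fin 3 → ℝ) (x y z : ℝ) :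
    dirDeriv G u (vec a b r x y z) =
      x * dirDeriv G u a + y * dirDeriv G u b + z * dirDeriv G u r := by
  simp only [vec, dirDeriv_add, dirDeriv_smul]

theorem dirDeriv_basis_ne_zero (hG : IsNonsingularCubic G) {a b r u : Fin 3 → ℝ}
    (hli : LinearIndependent ℝ ![a, b, r]) (hu0 : u ≠ 0) (hu : eval u G = 0)
    (ha : dirDeriv G u a = 0) (hb : dirDeriv G u b = 0) : dirDeriv G u r ≠ 0 := by
  intro hr
  obtain ⟨v, hv⟩ := exists_dirDeriv_ne_zero hG hu0 hu
  obtain ⟨x, y, z, rfl⟩ := exists_coords hli v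
  apply hv
  have := dirDeriv_vec G u a b r x y z
  rw [vec] at this
  rw [this, ha, hb, hr]; ring

/-- The tangent at `u` contains its residual point `r`. -/
theorem dirDeriv_eq_zero_of_third (hG : IsNonsingularCubic G) {u r : Fin 3 → ℝ} {hu : u ≠ 0}
    {hr : r ≠ 0} {hGu : eval u G = 0} {hGr : eval r G = 0}
    (h : third hG (pt hG u hu hGu) (pt hG u hu hGu) = pt hG r hr hGr)
    (hne : pt hG u hu hGu ≠ pt hG r hr hGr) :
    LinearIndependent ℝ ![u, r] ∧ dirDeriv G u r = 0 ∧ dirDeriv G r u ≠ 0 := by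
  have hli := linearIndependent_of_pt_ne hG hne
  -- Tangency is reread as u # r = u. The chord equation then has solution (s, t) = (1, 0), which
  -- says D_u r = 0.
  have h1 : third hG (pt hG u hu hGu) (pt hG r hr hGr) = pt hG u hu hGu := by
    rw [← h, third_third]
  obtain ⟨s, t, e, hst⟩ := chord_of_isThirdPoint hG hu hr hu hli ((third_eq_iff hG).mp h1)
  have h2 := LinearIndependent.pair_iff.mp hli (s - 1) t (by
    rw [sub_smul, one_smul, sub_add_eq_add_sub, ← e, sub_self])
  have h3 : dirDeriv G u r = 0 := by
    rw [h2.2, sub_eq_zero.mp h2.1] at hst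
    simpa using hst
  refine ⟨hli, h3, ?_⟩
  rcases dirDeriv_ne_zero_or hG hli hGu hGr with h | h
  exacts [absurd h3 h, h]

/-- At a flex the residual linear factor on the tangent vanishes at `u` itself, so the restricted
form is a nonzero multiple of a cube. -/
theorem flex_tangent (hG : IsNonsingularCubic G) {u : Fin 3 → ℝ} {hu : u ≠ 0}
    {hGu : eval u G = 0} (h : third hG (pt hG u hu hGu) (pt hG u hu hGu) = pt hG u hu hGu) :
    ∃ d, LinearIndependent ℝ ![u, d] ∧ dirDeriv G u d = 0 ∧ dirDeriv G d u = 0 ∧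
      eval d G ≠ 0 := by
  obtain ⟨d, hli, hd⟩ := exists_tangent_vector hG hu hGu
  obtain ⟨s, t, e, hst⟩ := tangent_of_isThirdPoint hG hu hu hli hd ((third_eq_iff hG).mp h)
  have h2 := LinearIndependent.pair_iff.mp hli (s - 1) t (by
    rw [sub_smul, one_smul, sub_add_eq_add_sub, ← e, sub_self])
  have h3 : dirDeriv G d u = 0 := by
    rw [h2.2, sub_eq_zero.mp h2.1] at hst
    simpa using hst
  refine ⟨d, hli, hd, h3, fun h4 => ?_⟩
  rcases dirDeriv_ne_zero_or hG hli hGu h4 with h | h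
  exacts [h hd, h h3]

/-- The points A, X and R = A # A form a triangle. In this basis the cubes vanish, and tangency of
AR and XR removes the terms x²z and y²z; rescaling A and X makes the coefficients of x²y and xy²
equal. -/
theorem translation_of_not_flex (hG : IsNonsingularCubic G) {A X : Curve G} (hne : A ≠ X)
    (h : third hG A A = third hG X X) (hA : third hG A A ≠ A) (hX : third hG X X ≠ X) :
    ∀ P Q : Curve G, P ≠ Q →
      third hG (third hG (third hG P A) X) (third hG (third hG Q A) X) = third hG P Q := by
  obtain ⟨a, ha, hGa, rfl⟩ := exists_pt hG A
  obtain ⟨b, hb, hGb, rfl⟩ := exists_pt hG X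
  obtain ⟨r, hr, hGr, hR⟩ := exists_pt hG (third hG (pt hG a ha hGa) (pt hG a ha hGa))
  obtain ⟨har, Dar, Dra⟩ := dirDeriv_eq_zero_of_third hG hR (by rw [← hR]; exact hA.symm)
  obtain ⟨hbr, Dbr, Drb⟩ := dirDeriv_eq_zero_of_third hG (h.symm.trans hR)
    (by rw [← hR, h]; exact hX.symm)
  have hab := linearIndependent_of_pt_ne hG hne
  have hli : LinearIndependent ℝ ![a, b, r] := by
    refine linearIndependent_of_vec fun x y z h0 => ?_
    -- The derivative at `a` kills `a` and `r`, the one at `b` kills `b` and `r`. Applied to a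
    -- linear relation they leave y·D_a b = 0 and x·D_b a = 0, and one of these derivatives is
    -- nonzero.
    have h1 := dirDeriv_vec G a a b r x y z
    have h2 := dirDeriv_vec G b a b r x y z
    have h3 := dirDeriv_smul G 0 a 0
    have h4 := dirDeriv_smul G 0 b 0
    rw [zero_smul] at h3 h4
    rw [h0, h3, dirDeriv_self hG.1, hGa, Dar] at h1
    rw [h0, h4, dirDeriv_self hG.1, hGb, Dbr] at h2
    simp at h1 h2
    rcases dirDeriv_ne_zero_or hG hab hGa hGb with h5 | h5
    · have hy : y = 0 := by tauto
      subst hy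
      have := LinearIndependent.pair_iff.mp har x z (by simpa [vec] using h0)
      exact ⟨this.1, rfl, this.2⟩
    · have hx : x = 0 := by tauto
      subst hx
      have := LinearIndependent.pair_iff.mp hbr y z (by simpa [vec] using h0)
      exact ⟨rfl, this.1, this.2⟩
  have hDab : dirDeriv G a b ≠ 0 := by
    intro h0
    exact dirDeriv_basis_ne_zero hG hli ha hGa (by rw [dirDeriv_self hG.1, hGa, mul_zero]) h0 Dar
  have hDba : dirDeriv G b a ≠ 0 := by
    intro h0
    exact dirDeriv_basis_ne_zero hG hli hb hGb h0 (by rw [dirDeriv_self hG.1, hGb, mul_zero]) Dbr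
  set c := dirDeriv G a b with hc
  set d := dirDeriv G b a with hd
  have hvec : ∀ x y z : ℝ, vec (c⁻¹ • a) (d⁻¹ • b) r x y z = vec a b r (x * c⁻¹) (y * d⁻¹) z := by
    intro x y z
    simp only [vec, smul_smul]
  refine translation_triangular hG (a := c⁻¹ • a) (b := d⁻¹ • b) (r := r) (κ := (c * d)⁻¹)
    (α := d * dirDeriv G r a) (β := c * dirDeriv G r b) (e := polar G a b r)
    (linearIndependent_of_vec fun x y z h0 => ?_) ?_ ?_ ?_ ?_ ?_ ?_
  · rw [hvec] at h0
    simpa [hDab, hDba] using vec_eq_zero hli h0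
  · exact inv_ne_zero (mul_ne_zero hDab hDba)
  · exact mul_ne_zero hDba Dra
  · exact mul_ne_zero hDab Drb
  · intro x y z
    rw [hvec, eval_vec hG, hGa, hGb, hGr, Dar, Dbr, ← hc, ← hd]
    field_simp
    ring
  · have hz : vec (c⁻¹ • a) (d⁻¹ • b) r 1 0 0 = c⁻¹ • a := by simp [vec]
    refine ⟨by rw [hz]; exact smul_ne_zero (inv_ne_zero hDab) ha,
      by rw [hz, eval_smul' hG.1, hGa, mul_zero], pt_eq_of_smul hG (k := c) ?_⟩
    rw [hz, smul_smul, mul_inv_cancel₀ hDab, one_smul]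
  · have hz : vec (c⁻¹ • a) (d⁻¹ • b) r 0 1 0 = d⁻¹ • b := by simp [vec]
    refine ⟨by rw [hz]; exact smul_ne_zero (inv_ne_zero hDba) hb,
      by rw [hz, eval_smul' hG.1, hGb, mul_zero], pt_eq_of_smul hG (k := d) ?_⟩
    rw [hz, smul_smul, mul_inv_cancel₀ hDba, one_smul]

/-- The basis consists of a direction on the flex tangent, the flex A, and X, whose tangent passes
through A. Only x³, x²z, y²z, xz² and xyz survive. -/
theorem translation_of_flex (hG : IsNonsingularCubic G) {A X : Curve G} (hne : A ≠ X)
    (h : third hG A A = third hG X X) (hA : third hG A A = A) :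
    ∀ P Q : Curve G, P ≠ Q →
      third hG (third hG (third hG P A) X) (third hG (third hG Q A) X) = third hG P Q := by
  obtain ⟨b, hb, hGb, rfl⟩ := exists_pt hG A
  obtain ⟨r, hr, hGr, rfl⟩ := exists_pt hG X
  obtain ⟨d, hbd, Dbd, Ddb, hGd⟩ := flex_tangent hG hA
  obtain ⟨hrb, Drb, Dbr⟩ := dirDeriv_eq_zero_of_third hG (h.symm.trans hA) hne.symm
  have hli : LinearIndependent ℝ ![d, b, r] := by
    refine linearIndependent_of_vec fun x y z h0 => ?_
    have h1 := dirDeriv_vec G b d b r x y z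
    have h3 := dirDeriv_smul G 0 b 0
    rw [zero_smul] at h3
    rw [h0, h3, dirDeriv_self hG.1, hGb, Dbd] at h1
    have hz : z = 0 := by simpa [Dbr] using h1
    subst hz
    have := LinearIndependent.pair_iff.mp hbd y x (by rw [add_comm]; simpa [vec] using h0)
    exact ⟨this.2, this.1, rfl⟩
  have Drd : dirDeriv G r d ≠ 0 := by
    intro h0
    obtain ⟨v, hv⟩ := exists_dirDeriv_ne_zero hG hr hGr
    obtain ⟨x, y, z, rfl⟩ := exists_coords hli v
    have := dirDeriv_vec G r d b r x y z
    rw [vec, h0, Drb, dirDeriv_self hG.1, hGr] at this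
    exact hv (by simpa using this)
  set ρ := eval d G with hρ
  set δ := dirDeriv G b r with hδ
  -- Rescaling `r` by μ makes the coefficient of y²z the negative of that of x³; the shear by `l`
  -- completes the square in y and removes xyz.
  obtain ⟨μ, hμ⟩ : ∃ μ, δ * μ = -ρ := ⟨-ρ / δ, by field_simp⟩
  have hμ0 : μ ≠ 0 := by
    rintro rfl
    exact hGd (by linarith)
  obtain ⟨l, hl⟩ : ∃ l, 2 * ρ * l = polar G d b r * μ :=
    ⟨polar G d b r * μ / (2 * ρ), by field_simp⟩
  have hvec : ∀ x y z : ℝ, vec (d + l • b) b (μ • r) x y z = vec d b r x (y + l * x) (μ * z) := by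
    intro x y z
    simp only [vec, smul_smul, smul_add, add_smul, mul_comm]
    abel
  refine translation_weierstrass hG (a := d + l • b) (b := b) (r := μ • r) (κ := ρ)
    (c := (dirDeriv G d r * μ - ρ * l ^ 2 + polar G d b r * μ * l) / ρ)
    (e := μ ^ 2 * dirDeriv G r d / ρ)
    (linearIndependent_of_vec fun x y z h0 => ?_) hGd ?_ ?_ ?_ ?_
  · rw [hvec] at h0
    obtain ⟨rfl, h2, h3⟩ := vec_eq_zero hli h0
    exact ⟨rfl, by simpa using h2, by simpa [hμ0] using h3⟩
  · exact div_ne_zero (mul_ne_zero (pow_ne_zero 2 hμ0) Drd) hGd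
  · intro x y z
    rw [hvec, eval_vec hG, hGb, hGr, Dbd, Ddb, Drb, ← hρ, ← hδ]
    field_simp
    linear_combination (y + l * x) ^ 2 * z * hμ - x * y * z * hl
  · have hz : vec (d + l • b) b (μ • r) 0 1 0 = b := by simp [vec]
    simp only [hz]
    exact ⟨hb, hGb, trivial⟩
  · have hz : vec (d + l • b) b (μ • r) 0 0 1 = μ • r := by simp [vec]
    refine ⟨by rw [hz]; exact smul_ne_zero hμ0 hr,
      by rw [hz, eval_smul' hG.1, hGr, mul_zero], pt_eq_of_smul hG (k := μ⁻¹) ?_⟩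
    rw [hz, smul_smul, inv_mul_cancel₀ hμ0, one_smul]

theorem translation_of_ne (hG : IsNonsingularCubic G) {A X : Curve G} (hne : A ≠ X)
    (h : third hG A A = third hG X X) (P Q : Curve G) (hPQ : P ≠ Q) :
    third hG (third hG (third hG P A) X) (third hG (third hG Q A) X) = third hG P Q := by
  by_cases hA : third hG A A = A
  · exact translation_of_flex hG hne h hA P Q hPQ
  by_cases hX : third hG X X = X
  · have key := translation_of_flex hG hne.symm h.symm hX
    have e : third hG (third hG A X) A = X := by rw [third_comm, third_third]
    have sw : ∀ P, third hG (third hG P A) X = third hG (third hG P X) A := by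
      intro P
      by_cases hP : P = A
      · subst hP
        rw [h, hX, e, hX]
      · have := key P A hP
        rw [e] at this
        rw [← this, third_comm hG _ X, third_comm hG _ X, third_third]
    rw [sw, sw]
    exact key P Q hPQ
  · exact translation_of_not_flex hG hne h hA hX P Q hPQ

/-! ### Points with a common residual tangential point -/

theorem exists_root_cubic (p q s t : ℝ) (hp : p ≠ 0) :
    ∃ x : ℝ, p * x ^ 3 + q * x ^ 2 + s * x + t = 0 := by
  suffices h : ∀ q s t : ℝ, ∃ x : ℝ, x ^ 3 + q * x ^ 2 + s * x + t = 0 by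
    obtain ⟨x, hx⟩ := h (q / p) (s / p) (t / p)
    refine ⟨x, ?_⟩
    field_simp at hx
    linear_combination hx
  intro q s t
  -- At ±M the leading term dominates the others, so the cubic changes sign on [−M, M].
  set M := 1 + |q| + |s| + |t| with hM
  have hq := abs_nonneg q
  have hs := abs_nonneg s
  have ht := abs_nonneg t
  have hM1 : 1 ≤ M := by linarith
  have hM2 : M ≤ M ^ 2 := by nlinarith
  have b1 : |q| * M ^ 2 + |s| * M + |t| ≤ M ^ 3 := by
    have e : M ^ 3 = M ^ 2 + |q| * M ^ 2 + |s| * M ^ 2 + |t| * M ^ 2 := by rw [hM]; ring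
    nlinarith
  have c1 := abs_le.mp (le_refl |q|)
  have c2 := abs_le.mp (le_refl |s|)
  have c3 := abs_le.mp (le_refl |t|)
  have hcont : ContinuousOn (fun x : ℝ => x ^ 3 + q * x ^ 2 + s * x + t) (Set.Icc (-M) M) := by
    fun_prop
  obtain ⟨x, -, hx⟩ := intermediate_value_Icc (by linarith) hcont (show (0 : ℝ) ∈ _ from
    ⟨by
      show (-M) ^ 3 + q * (-M) ^ 2 + s * (-M) + t ≤ 0
      nlinarith, by
      show 0 ≤ M ^ 3 + q * M ^ 2 + s * M + t
      nlinarith⟩)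
  exact ⟨x, hx⟩

/-- Every point shares its residual tangential point with another point. -/
theorem exists_ne_third_self_eq (hG : IsNonsingularCubic G) (A : Curve G) :
    ∃ X, A ≠ X ∧ third hG A A = third hG X X := by
  by_cases hA : third hG A A = A
  · obtain ⟨b, hb, hGb, rfl⟩ := exists_pt hG A
    obtain ⟨d, hbd, Dbd, Ddb, hGd⟩ := flex_tangent hG hA
    have hdb : LinearIndependent ℝ ![d, b] := LinearIndependent.pair_symm_iff.mp hbd
    have hli := linearIndependent_triple_cross hdb
    set r := crossProduct d b
    have Dbr : dirDeriv G b r ≠ 0 := dirDeriv_basis_ne_zero hG hli hb hGb Dbd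
      (by rw [dirDeriv_self hG.1, hGb, mul_zero])
    have hF := eval_vec hG d b r
    simp only [hGb, Dbd, Ddb] at hF
    set ρ := eval d G
    set δ := dirDeriv G b r
    set m := dirDeriv G r b
    set T := polar G d b r
    -- On the line through the flex `b` with given x (and z = 1) the cubic is quadratic in y with
    -- leading coefficient δ. The root makes its discriminant vanish, so the line touches the curve
    -- at the double root y.
    obtain ⟨x, hx⟩ := exists_root_cubic (4 * δ * ρ) (4 * δ * dirDeriv G d r - T ^ 2)
      (4 * δ * dirDeriv G r d - 2 * T * m) (4 * δ * eval r G - m ^ 2)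
      (mul_ne_zero (mul_ne_zero (by norm_num) Dbr) hGd)
    obtain ⟨y, hy⟩ : ∃ y, 2 * δ * y = -(m + T * x) := ⟨-(m + T * x) / (2 * δ), by field_simp⟩
    have hX0 : vec d b r x y 1 ≠ 0 := vec_ne_zero hli (by simp)
    have hXG : eval (vec d b r x y 1) G = 0 := by
      rw [hF]
      apply mul_left_cancel₀ (mul_ne_zero (show (4 : ℝ) ≠ 0 by norm_num) Dbr)
      linear_combination hx + (2 * δ * y + m + T * x) * hy
    have hb' : vec d b r 0 1 0 = b := by simp [vec]
    have hXb : LinearIndependent ℝ ![vec d b r x y 1, b] := by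
      have := linearIndependent_vec hli (x := x) (y := y) (z := 1) (x' := 0) (y' := 1) (z' := 0)
        (by simp)
      rwa [hb'] at this
    refine ⟨pt hG _ hX0 hXG, (pt_ne_of_linearIndependent hG hXb).symm, ?_⟩
    rw [hA]
    refine (third_pt_tangent hG hXb ?_ 0 1 (by simp) (by rw [hGb]; ring)).symm
    have e := dirDeriv_eq hG (vec d b r x y 1) (vec d b r 0 1 0)
    rw [smul_vec, vec_add_vec, vec_add_vec, hF, hF, hF, hb'] at e
    rw [e]
    linear_combination hy
  · obtain ⟨a, ha, hGa, rfl⟩ := exists_pt hG A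
    obtain ⟨r, hr, hGr, hR⟩ := exists_pt hG (third hG (pt hG a ha hGa) (pt hG a ha hGa))
    obtain ⟨har, Dar, Dra⟩ := dirDeriv_eq_zero_of_third hG hR (by rw [← hR]; exact fun h => hA h.symm)
    have hli := linearIndependent_triple_cross har
    set b := crossProduct a r
    have Dab : dirDeriv G a b ≠ 0 := dirDeriv_basis_ne_zero hG hli ha hGa
      (by rw [dirDeriv_self hG.1, hGa, mul_zero]) Dar
    have hF := eval_vec hG a r b
    simp only [hGa, hGr, Dar] at hF
    have hr' : vec a r b 0 1 0 = r := by simp [vec]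
    have hD : ∀ x z y : ℝ, dirDeriv G (vec a r b x z y) r = dirDeriv G b r * y ^ 2
        + 2 * z * (dirDeriv G r a * x + dirDeriv G r b * y) + polar G a r b * x * y := by
      intro x z y
      have e := dirDeriv_eq hG (vec a r b x z y) (vec a r b 0 1 0)
      rw [smul_vec, vec_add_vec, vec_add_vec, hF, hF, hF, hr'] at e
      rw [e]; ring
    set α := dirDeriv G r a
    set β := dirDeriv G r b
    set c := dirDeriv G a b
    set d := dirDeriv G b a
    set m := dirDeriv G b r
    set T := polar G a r b
    set f := eval b G
    -- Lines through `r` other than the tangent at `a` are given by x (with last coordinate 1), and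
    -- on them the cubic is (αx + β)z² + (Tx + m)z + (cx² + dx + f). Its discriminant has degree
    -- exactly three in x because α and c are nonzero.
    obtain ⟨x, hx⟩ := exists_root_cubic (-4 * α * c) (T ^ 2 - 4 * α * d - 4 * β * c)
      (2 * T * m - 4 * α * f - 4 * β * d) (m ^ 2 - 4 * β * f)
      (mul_ne_zero (mul_ne_zero (by norm_num) Dra) Dab)
    have hdisc : (T * x + m) ^ 2 = 4 * (α * x + β) * (c * x ^ 2 + d * x + f) := by
      linear_combination hx
    rw [hR]
    -- If the leading coefficient vanishes, so does the middle one: the line meets the cubic three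
    -- times at `r`, which is then a flex and serves as X itself. Otherwise the double root z gives
    -- X.
    by_cases hL : α * x + β = 0
    · have hQ : T * x + m = 0 := by
        rw [hL, mul_zero, zero_mul] at hdisc
        exact pow_eq_zero_iff (two_ne_zero) |>.mp hdisc
      refine ⟨pt hG r hr hGr, fun h => hA (hR.trans h.symm), ?_⟩
      have hrw : LinearIndependent ℝ ![r, vec a r b x 0 1] := by
        have := linearIndependent_vec hli (x := 0) (y := 1) (z := 0) (x' := x) (y' := 0) (z' := 1)
          (by simp)
        rwa [hr'] at this
      refine (third_pt_tangent hG hrw ?_ 1 0 (by simp) ?_).symm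
      · rw [dirDeriv_vec, dirDeriv_self hG.1, hGr]
        linear_combination hL
      · rw [hD]
        linear_combination hQ
    · obtain ⟨z, hz⟩ : ∃ z, 2 * (α * x + β) * z = -(T * x + m) :=
        ⟨-(T * x + m) / (2 * (α * x + β)), by field_simp⟩
      have hX0 : vec a r b x z 1 ≠ 0 := vec_ne_zero hli (by simp)
      have hXG : eval (vec a r b x z 1) G = 0 := by
        rw [hF]
        apply mul_left_cancel₀ (mul_ne_zero (show (4 : ℝ) ≠ 0 by norm_num) hL)
        linear_combination (2 * (α * x + β) * z + (T * x + m)) * hz - hdisc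
      have hXr : LinearIndependent ℝ ![vec a r b x z 1, r] := by
        have := linearIndependent_vec hli (x := x) (y := z) (z := 1) (x' := 0) (y' := 1) (z' := 0)
          (by simp)
        rwa [hr'] at this
      have hXa : LinearIndependent ℝ ![vec a r b x z 1, a] := by
        have := linearIndependent_vec hli (x := x) (y := z) (z := 1) (x' := 1) (y' := 0) (z' := 0)
          (by simp)
        rwa [show vec a r b 1 0 0 = a by simp [vec]] at this
      refine ⟨pt hG _ hX0 hXG, (pt_ne_of_linearIndependent hG hXa).symm, ?_⟩
      refine (third_pt_tangent hG hXr ?_ 0 1 (by simp) (by rw [hGr]; ring)).symm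
      rw [hD]
      linear_combination hz

/-! ### Formal theory of translations of order two -/

/-- The properties of the translation by a point of order two in terms of the chord operation. -/
structure IsTwoTranslation {E : Type*} (op : E → E → E) (σ : E → E) : Prop where
  op_op : ∀ P Q, op (σ P) (σ Q) = op P Q
  involutive : ∀ P, σ (σ P) = P
  ne : ∀ P, σ P ≠ P

/-- Tangents need no separate computation: the identity for chords through distinct points, together
with the symmetries of #, forces the one for P = Q. -/
theorem IsTwoTranslation.of_distinct {E : Type*} {op : E → E → E}
    (comm : ∀ P Q, op P Q = op Q P) (cancel : ∀ P Q, op P (op P Q) = Q) {A X : E} (hne : A ≠ X)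
    (hR : op A A = op X X)
    (key : ∀ P Q, P ≠ Q → op (op (op P A) X) (op (op Q A) X) = op P Q) :
    IsTwoTranslation op (fun P => op (op P A) X) := by
  have inj : ∀ {P Q R}, op P R = op Q R → P = Q := fun {P Q R} h => by
    rw [← cancel R P, ← cancel R Q, comm R P, comm R Q, h]
  have solve : ∀ {P Q R}, op P Q = R → op P R = Q := fun {P Q R} h => by rw [← h, cancel]
  obtain ⟨σ, hσ⟩ : ∃ σ : E → E, σ = fun P => op (op P A) X := ⟨_, rfl⟩
  have hσ' : ∀ P, op (op P A) X = σ P := fun P => (congrFun hσ P).symm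
  simp only [hσ'] at key
  rw [← hσ]
  have sA : σ A = X := by rw [← hσ', hR, comm, cancel]
  have sX : σ X = A := by rw [← hσ', comm, cancel]
  have s_inj : ∀ {P Q}, σ P = σ Q → P = Q := fun {P Q} h => by
    rw [← hσ', ← hσ'] at h
    exact inj (inj h)
  have s_ne : ∀ P, σ P ≠ P := fun P h => by
    rw [← hσ', comm] at h
    have h1 := solve h
    have h2 : op P A = op P X := by rw [comm P X, h1]
    exact hne (inj (R := P) (by rw [comm, h2, comm]))
  have s_inv : ∀ P, σ (σ P) = P := by
    intro P
    by_cases hP : P = A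
    · rw [hP, sA, sX]
    · have h1 := key (σ P) X (fun h => hP (s_inj (h.trans sA.symm)))
      have h2 : op X (σ P) = op P A := solve (by rw [comm, hσ'])
      rw [sX, comm (σ P), h2] at h1
      exact inj h1
  refine ⟨?_, s_inv, s_ne⟩
  -- With T = P # P, the chord identity for P, T gives σP # σT = P. For σT, P it gives T # σP = σT #
  -- P = σP, whence σP # σP = T.
  have not_flex : ∀ P, op P P ≠ P → op P P ≠ σ P → op (σ P) (σ P) = op P P := by
    intro P h1 h2
    have hS := key P (op P P) h1.symm
    rw [cancel] at hS
    have hne' : σ (op P P) ≠ P := fun h => h2 (by rw [← h, s_inv, h])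
    have h3 := key (σ (op P P)) P hne'
    rw [s_inv, solve (by rw [comm]; exact hS : op (σ (op P P)) (σ P) = P)] at h3
    exact solve (by rw [comm]; exact h3)
  -- For V = P # σP the chord identity gives σP # σV = P # V = σP. If σP is a flex this forces σV =
  -- σP, hence V = P, which is impossible when P is a flex.
  have both : ∀ P, op P P = P → op (σ P) (σ P) = σ P → False := by
    intro P h1 h2
    have hV : P ≠ op P (σ P) := fun h => s_ne P (by
      have := solve h.symm
      rw [h1] at this
      exact this.symm)
    have h3 := key P (op P (σ P)) hV
    rw [cancel] at h3
    have h4 := solve h3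
    rw [h2] at h4
    exact hV (s_inj h4)
  intro P Q
  by_cases hPQ : P = Q
  swap
  · exact key P Q hPQ
  subst hPQ
  have image : op (σ P) (σ P) ≠ σ P → op (σ P) (σ P) ≠ P → op (σ P) (σ P) = op P P := by
    intro h1 h2
    have := not_flex (σ P) h1 (by rwa [s_inv])
    rw [s_inv] at this
    exact this.symm
  -- Only the cases where P # P and σP # σP both lie in {P, σP} escape `not_flex`, applied to P or
  -- to σP. There the two values agree, or both points are flexes, or each has the other as residual
  -- point; the last two are contradictory.
  by_cases h1 : op P P = P
  · by_cases h3 : op (σ P) (σ P) = σ P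
    · exact (both P h1 h3).elim
    by_cases h4 : op (σ P) (σ P) = P
    · rw [h4, h1]
    · exact image h3 h4
  by_cases h2 : op P P = σ P
  · by_cases h3 : op (σ P) (σ P) = σ P
    · rw [h3, h2]
    by_cases h4 : op (σ P) (σ P) = P
    · exfalso
      have h5 := solve h2
      have h6 := solve h4
      rw [comm] at h6
      exact s_ne P (h6.symm.trans h5)
    · exact image h3 h4
  · exact not_flex P h1 h2

/-- This identifies the second point of a Schroeter step as the partner of the first. From σP # σ(P
# Q) = P # (P # Q) = Q one gets σ(P # Q) = σP # Q, which equals P # σQ. -/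
theorem IsTwoTranslation.op_apply {E : Type*} {op : E → E → E} {σ : E → E}
    (h : IsTwoTranslation op σ)
    (cancel : ∀ P Q, op P (op P Q) = Q) (P Q : E) : σ (op P Q) = op P (σ Q) := by
  have h1 : op (σ P) (σ (op P Q)) = Q := by rw [h.op_op, cancel]
  have h2 : op (σ P) Q = σ (op P Q) := by rw [← cancel (σ P) (σ (op P Q)), h1]
  rw [← h2, ← h.op_op, h.involutive]

/-- The combinatorial core: a translation by a point of order two that does not map one of three
given points to another one. -/
theorem exists_twoTranslation_avoiding {E : Type*} {op : E → E → E}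
    (comm : ∀ P Q, op P Q = op Q P) (cancel : ∀ P Q, op P (op P Q) = Q)
    (exists_of_ne : ∀ A X, A ≠ X → op A A = op X X →
      IsTwoTranslation op (fun P => op (op P A) X))
    {σ : E → E} (hσ : IsTwoTranslation op σ) {S : Set E}
    (hS : ∀ P ∈ S, ∀ Q ∈ S, P ≠ Q → ∃ C, ∀ U ∈ S, U = P ∨ U = Q ∨ U = C)
    (hex : ∀ P ∈ S, ∀ Q ∈ S, P ≠ Q → op P P = op Q Q →
      ∃ X Y, X ≠ Y ∧ X ∉ S ∧ Y ∉ S ∧ op X X = op P P ∧ op Y Y = op P P) :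
    ∃ τ, IsTwoTranslation op τ ∧ ∀ U ∈ S, ∀ W ∈ S, τ U ≠ W := by
  by_contra! hcon
  obtain ⟨P, hP, Q, hQ, hPQ⟩ := hcon σ hσ
  have hne : P ≠ Q := fun h => hσ.ne P (hPQ.trans h.symm)
  obtain ⟨X, Y, hXY, hX, hY, hXX, hYY⟩ := hex P hP Q hQ hne (by rw [← hPQ, hσ.op_op])
  obtain ⟨C, hC⟩ := hS P hP Q hQ hne
  -- The translation taking P to Z exchanges P with a point outside `S` and has no fixed point. If
  -- it still maps a point of `S` into `S`, it must exchange Q and C, in whichever direction this is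
  -- found.
  have bad : ∀ Z, Z ∉ S → op Z Z = op P P → op (op Q P) Z = C := by
    intro Z hZ hZZ
    have hτ := exists_of_ne P Z (fun h => hZ (h ▸ hP)) hZZ.symm
    obtain ⟨U, hU, W, hW, hUW⟩ := hcon _ hτ
    have h1 := hτ.ne
    have h2 := hτ.involutive
    have hPZ : op (op P P) Z = Z := by rw [← hZZ, comm, cancel]
    rcases hC U hU with rfl | rfl | rfl
    · rw [hPZ] at hUW
      exact absurd (hUW ▸ hW) hZ
    · rcases hC W hW with rfl | rfl | rfl
      · have h3 := h2 U
        rw [hUW, hPZ] at h3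
        exact absurd (h3 ▸ hU) hZ
      · exact absurd hUW (h1 _)
      · exact hUW
    · rcases hC W hW with rfl | rfl | rfl
      · have h3 := h2 U
        rw [hUW, hPZ] at h3
        exact absurd (h3 ▸ hU) hZ
      · rw [← hUW, h2]
      · exact absurd hUW (h1 _)
  -- Both X and Y solve (Q # P) # Z = C, whose solution is unique.
  have e := (bad X hX hXX).trans (bad Y hY hYY).symm
  exact hXY (by rw [← cancel (op Q P) X, e, cancel])

theorem exists_isTwoTranslation (hG : IsNonsingularCubic G) {A X : Curve G} (hne : A ≠ X)
    (h : third hG A A = third hG X X) :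
    IsTwoTranslation (third hG) (fun P => third hG (third hG P A) X) :=
  IsTwoTranslation.of_distinct (third_comm hG) (third_third hG) hne h
    (translation_of_ne hG hne h)

/-! ### Incidences and Schroeter steps on the curve -/

theorem eq_cross_of_orthogonal {l m X : RPoint} (h : l ≠ m) (hl : X.orthogonal l)
    (hm : X.orthogonal m) : X = Projectivization.cross l m := by
  induction l using Projectivization.ind with | h u hu =>
  induction m using Projectivization.ind with | h v hv =>
  induction X using Projectivization.ind with | h w hw =>
  rw [Projectivization.orthogonal_mk] at hl hm
  rw [Projectivization.cross_mk_of_ne hu hv h,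
    Projectivization.mk_eq_mk_iff_crossProduct_eq_zero, cross_cross_eq_smul_sub_smul',
    dotProduct_comm u, hl, hm]
  simp

theorem lineThrough_orthogonal {P Q : RPoint} (h : P ≠ Q) :
    P.orthogonal (lineThrough P Q) ∧ Q.orthogonal (lineThrough P Q) :=
  ⟨Projectivization.orthogonal_cross_left h, Projectivization.orthogonal_cross_right h⟩

/-- A line contains at most three points of the curve. -/
theorem noFourCollinear_of_subset (hG : IsNonsingularCubic G) {M : Set RPoint}
    (hM : M ⊆ cubicCurve G) : NoFourCollinear M := by
  intro l
  by_cases hs : {P ∈ M | P.orthogonal l}.Subsingleton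
  · exact (Set.encard_le_one_iff_subsingleton.mpr hs).trans (by norm_num)
  · rw [Set.not_subsingleton_iff] at hs
    obtain ⟨P, ⟨hP, hPl⟩, Q, ⟨hQ, hQl⟩, hPQ⟩ := hs
    obtain ⟨R, hR⟩ := exists_isThirdPoint hG (hM hP) (hM hQ)
    have hl : l = lineThrough P Q :=
      eq_cross_of_orthogonal hPQ (Projectivization.orthogonal_comm.mp hPl)
        (Projectivization.orthogonal_comm.mp hQl)
    have hsub : {P ∈ M | P.orthogonal l} ⊆ {P, Q, R} := by
      rintro X ⟨hX, hXl⟩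
      rw [hl] at hXl
      rcases eq_or_isThirdPoint_of_orthogonal hG (hM hP) (hM hQ) (hM hX) hPQ hXl with h | h | h
      · simp [h]
      · simp [h]
      · simp [isThirdPoint_unique hG h hR]
    refine (Set.encard_le_encard hsub).trans ?_
    refine (Set.encard_insert_le _ _).trans ?_
    refine (add_le_add_left (Set.encard_insert_le _ _) 1).trans ?_
    rw [Set.encard_singleton]
    norm_num

/-- On a common line both P' and Q', being different from P and Q, would have to be the unique point
P # Q. -/
theorem lineThrough_ne (hG : IsNonsingularCubic G) {P Q P' Q' : RPoint} (hP : P ∈ cubicCurve G)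
    (hQ : Q ∈ cubicCurve G) (hP' : P' ∈ cubicCurve G) (hQ' : Q' ∈ cubicCurve G) (h₁ : P ≠ Q)
    (h₂ : P' ≠ Q') (h₃ : P' ≠ P) (h₄ : P' ≠ Q) (h₅ : Q' ≠ P) (h₆ : Q' ≠ Q) :
    lineThrough P Q ≠ lineThrough P' Q' := by
  intro h
  obtain ⟨e₁, e₂⟩ := lineThrough_orthogonal h₂
  rw [← h] at e₁ e₂
  rcases eq_or_isThirdPoint_of_orthogonal hG hP hQ hP' h₁ e₁ with h | h | h
  · exact h₃ h
  · exact h₄ h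
  rcases eq_or_isThirdPoint_of_orthogonal hG hP hQ hQ' h₁ e₂ with h' | h' | h'
  · exact h₅ h'
  · exact h₆ h'
  · exact h₂ (isThirdPoint_unique hG h h')

/-- The pairs `P, σ P` are closed under Schroeter's construction. -/
theorem schroeterPair_of_translation (hG : IsNonsingularCubic G) {σ : Curve G → Curve G}
    (hσ : IsTwoTranslation (third hG) σ) (A B C : Curve G) {S S' : RPoint}
    (h : IsSchroeterPair A (σ A) B (σ B) C (σ C) S S') :
    ∃ P : Curve G, S = P ∧ S' = σ P := by
  induction h with
  | pairA => exact ⟨A, rfl, rfl⟩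
  | pairB => exact ⟨B, rfl, rfl⟩
  | pairC => exact ⟨C, rfl, rfl⟩
  | step _ _ hstep ihP ihQ =>
    obtain ⟨P, rfl, rfl⟩ := ihP
    obtain ⟨Q, rfl, rfl⟩ := ihQ
    refine ⟨third hG P Q, hstep.eq.trans ?_, hstep.eq'.trans ?_⟩
    · refine (eq_cross_of_orthogonal hstep.lines_ne ?_ ?_).symm
      · exact isThirdPoint_orthogonal_lineThrough hG (third_spec hG P Q) hstep.ne₁
      · rw [← hσ.op_op]
        exact isThirdPoint_orthogonal_lineThrough hG (third_spec hG (σ P) (σ Q)) hstep.ne₂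
    -- The partner σ(P # Q) = P # σQ is also σP # Q, so it lies on both lines of the second
    -- intersection.
    · rw [hσ.op_apply (third_third hG)]
      refine (eq_cross_of_orthogonal hstep.lines_ne' ?_ ?_).symm
      · exact isThirdPoint_orthogonal_lineThrough hG (third_spec hG P (σ Q)) hstep.ne₃
      · have := third_spec hG (σ P) Q
        rw [← hσ.op_op, hσ.involutive] at this
        exact isThirdPoint_orthogonal_lineThrough hG this hstep.ne₄

theorem schroeterStep_of_translation (hG : IsNonsingularCubic G) {σ : Curve G → Curve G}
    (hσ : IsTwoTranslation (third hG) σ) {P Q : Curve G} (h : P ≠ Q) (h₁ : σ P ≠ Q)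
    (h₂ : σ Q ≠ P) :
    ∃ D' : RPoint, SchroeterStep P (σ P) Q (σ Q) (third hG P Q) D' := by
  have h₃ : σ P ≠ σ Q := fun e => h (by rw [← hσ.involutive P, e, hσ.involutive])
  have c : ∀ {X Y : Curve G}, X ≠ Y → (X : RPoint) ≠ Y := fun h e => h (Subtype.ext e)
  have l₁ : lineThrough (P : RPoint) Q ≠ lineThrough (σ P : RPoint) (σ Q) :=
    lineThrough_ne hG P.2 Q.2 (σ P).2 (σ Q).2 (c h) (c h₃) (c (hσ.ne P)) (c h₁) (c h₂)
      (c (hσ.ne Q))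
  have l₂ : lineThrough (P : RPoint) (σ Q) ≠ lineThrough (σ P : RPoint) Q :=
    lineThrough_ne hG P.2 (σ Q).2 (σ P).2 Q.2 (c h₂.symm) (c h₁) (c (hσ.ne P)) (c h₃)
      (c h.symm) (c (hσ.ne Q).symm)
  refine ⟨_, c h, c h₃, c h₂.symm, c h₁, l₁, l₂, eq_cross_of_orthogonal l₁ ?_ ?_, rfl⟩
  · exact isThirdPoint_orthogonal_lineThrough hG (third_spec hG P Q) (c h)
  · rw [← hσ.op_op]
    exact isThirdPoint_orthogonal_lineThrough hG (third_spec hG (σ P) (σ Q)) (c h₃)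

end SchroeterCubic

/-! ### The theorem -/

open SchroeterCubic

theorem theorem11 (G : MvPolynomial (Fin 3) ℝ) (hG : IsNonsingularCubic G)
    (A B C : RPoint) (hA : A ∈ cubicCurve G) (hB : B ∈ cubicCurve G) (hC : C ∈ cubicCurve G)
    (hAB : A ≠ B) (hBC : B ≠ C) (hCA : C ≠ A) :
    ∃ A' ∈ cubicCurve G, ∃ B' ∈ cubicCurve G, ∃ C' ∈ cubicCurve G,
    ∃ D ∈ cubicCurve G, ∃ E ∈ cubicCurve G, ∃ F ∈ cubicCurve G,
      A' ≠ A ∧ B' ≠ B ∧ C' ≠ C ∧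
      (IsThirdPoint G A B D ∧ IsThirdPoint G A' B' D) ∧
      (IsThirdPoint G B C E ∧ IsThirdPoint G B' C' E) ∧
      (IsThirdPoint G C A F ∧ IsThirdPoint G C' A' F) ∧
      (∀ S S', IsSchroeterPair A A' B B' C C' S S' →
        S ∈ cubicCurve G ∧ S' ∈ cubicCurve G) ∧
      (¬ IsExceptional G A B C →
        [A, A', B, B', C, C'].Nodup ∧
        NoFourCollinear {A, A', B, B', C, C'} ∧
        ∃ D' E' F' : RPoint,
          SchroeterStep A A' B B' D D' ∧
          SchroeterStep B B' C C' E E' ∧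
          SchroeterStep C C' A A' F F') := by
  lift A to Curve G using hA
  lift B to Curve G using hB
  lift C to Curve G using hC
  have hAB' : A ≠ B := fun h => hAB (congrArg _ h)
  have hBC' : B ≠ C := fun h => hBC (congrArg _ h)
  have hCA' : C ≠ A := fun h => hCA (congrArg _ h)
  obtain ⟨X, hAX, hX⟩ := exists_ne_third_self_eq hG A
  have hσ₀ := exists_isTwoTranslation hG hAX hX
  -- A single σ must serve both halves of the statement: any translation will do for an exceptional
  -- triple, an avoiding one is chosen otherwise.
  obtain ⟨σ, hσ, hgood⟩ : ∃ σ, IsTwoTranslation (third hG) σ ∧ (¬ IsExceptional G A B C →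
      ∀ U ∈ ({A, B, C} : Set (Curve G)), ∀ W ∈ ({A, B, C} : Set (Curve G)), σ U ≠ W) := by
    by_cases hex : IsExceptional G A B C
    · exact ⟨_, hσ₀, fun h => absurd hex h⟩
    have mem : ∀ {U : Curve G}, (U : RPoint) ∈ ({(A : RPoint), (B : RPoint), (C : RPoint)} :
        Set RPoint) ↔ U ∈ ({A, B, C} : Set (Curve G)) := by
      intro U
      simp only [Set.mem_insert_iff, Set.mem_singleton_iff, Subtype.ext_iff]
    obtain ⟨σ, hσ, h⟩ := exists_twoTranslation_avoiding (third_comm hG) (third_third hG)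
      (fun A X => exists_isTwoTranslation hG) hσ₀ (S := {A, B, C}) (by
        rintro P (rfl | rfl | rfl) Q (rfl | rfl | rfl) hne
        · exact absurd rfl hne
        · exact ⟨C, by rintro U (h | h | h) <;> tauto⟩
        · exact ⟨B, by rintro U (h | h | h) <;> tauto⟩
        · exact ⟨C, by rintro U (h | h | h) <;> tauto⟩
        · exact absurd rfl hne
        · exact ⟨A, by rintro U (h | h | h) <;> tauto⟩
        · exact ⟨B, by rintro U (h | h | h) <;> tauto⟩
        · exact ⟨A, by rintro U (h | h | h) <;> tauto⟩
        · exact absurd rfl hne) (by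
        intro P hP Q hQ hne hPQ
        by_contra hno
        refine hex ⟨P, mem.mpr hP, Q, mem.mpr hQ, fun h => hne (Subtype.ext h), third hG P P,
          third_spec hG P P, hPQ ▸ third_spec hG Q Q, ?_⟩
        rintro ⟨X, Y, hXY, hXm, hYm, hX, hY⟩
        lift X to Curve G using isThirdPoint_mem_left hX
        lift Y to Curve G using isThirdPoint_mem_left hY
        exact hno ⟨X, Y, fun h => hXY (congrArg _ h), mt mem.mpr hXm, mt mem.mpr hYm,
          (third_eq_iff hG).mpr hX, (third_eq_iff hG).mpr hY⟩)
    exact ⟨σ, hσ, fun _ => h⟩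
  have c : ∀ {X Y : Curve G}, X ≠ Y → (X : RPoint) ≠ Y := fun h e => h (Subtype.ext e)
  have sec : ∀ P Q : Curve G, IsThirdPoint G P Q (third hG P Q) ∧
      IsThirdPoint G (σ P) (σ Q) (third hG P Q) := fun P Q =>
    ⟨third_spec hG P Q, by rw [← hσ.op_op P Q]; exact third_spec hG (σ P) (σ Q)⟩
  refine ⟨σ A, (σ A).2, σ B, (σ B).2, σ C, (σ C).2, third hG A B, (third hG A B).2,
    third hG B C, (third hG B C).2, third hG C A, (third hG C A).2, c (hσ.ne A), c (hσ.ne B),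
    c (hσ.ne C), sec A B, sec B C, sec C A, ?_, ?_⟩
  · intro S S' h
    obtain ⟨P, rfl, rfl⟩ := schroeterPair_of_translation hG hσ A B C h
    exact ⟨P.2, (σ P).2⟩
  · intro hex
    have hg := hgood hex
    have inj : ∀ {P Q}, P ≠ Q → σ P ≠ σ Q := fun {P Q} h e =>
      h (by rw [← hσ.involutive P, e, hσ.involutive])
    have mA : A ∈ ({A, B, C} : Set (Curve G)) := by simp
    have mB : B ∈ ({A, B, C} : Set (Curve G)) := by simp
    have mC : C ∈ ({A, B, C} : Set (Curve G)) := by simp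
    refine ⟨?_, noFourCollinear_of_subset hG ?_, ?_⟩
    · simp only [List.nodup_cons, List.mem_cons, List.not_mem_nil, or_false, not_or,
        not_false_eq_true, List.nodup_nil, and_true]
      exact ⟨⟨c (hσ.ne A).symm, hAB, c (hg B mB A mA).symm, hCA.symm, c (hg C mC A mA).symm⟩,
        ⟨c (hg A mA B mB), c (inj hAB'), c (hg A mA C mC), c (inj hCA'.symm)⟩,
        ⟨c (hσ.ne B).symm, hBC, c (hg C mC B mB).symm⟩, ⟨c (hg B mB C mC), c (inj hBC')⟩,
        c (hσ.ne C).symm⟩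
    · rintro P (rfl | rfl | rfl | rfl | rfl | rfl) <;> exact Subtype.property _
    · obtain ⟨D', hD⟩ := schroeterStep_of_translation hG hσ hAB' (hg A mA B mB) (hg B mB A mA)
      obtain ⟨E', hE⟩ := schroeterStep_of_translation hG hσ hBC' (hg B mB C mC) (hg C mC B mB)
      obtain ⟨F', hF⟩ := schroeterStep_of_translation hG hσ hCA' (hg C mC A mA) (hg A mA C mC)
      exact ⟨D', E', F', hD, hE, hF⟩
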